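/- **Setting.** Let $\Omega\subset\mathbb R^n$ be nonempty, open, connected and of class $C^{1,1}$, and let $\bar\varepsilon>0$ be such that every $x\in\partial\Omega$ is touched by an interior and an exterior ball of radius $\bar\varepsilon$, i.e. there are $x_i,x_e$ with $B_{\bar\varepsilon}(x_i)\subset\Omega$, $B_{\bar\varepsilon}(x_e)\subset(\overline\Omega)^c$ and $|x-x_i|=|x-x_e|=\bar\varepsilon$. Assume that, for some $L>0$, $d_{\overline\Omega}(x,y)\le L|x-y|$ for all $x,y\in\overline\Omega$, where $d_{\overline\Omega}(x,y)$ is the infimum of the lengths of the Lipschitz curves in $\overline\Omega$ joining $x$ and $y$. A bounded set $U\subset\mathbb R^n$ is a *John domain* with center $x_0\in U$ and constant $\kappa\in(0,1]$ if for every $x\in U$ there is an arc-length parametrized curve $\gamma:[0,\ell]\to U$ with $\gamma(0)=x$, $\gamma(\ell)=x_0$ and $d(\gamma(s),\partial U)\ge\kappa s$ for all $s\in[0,\ell]$. Let $V_0\subset\Omega$ be open and a John domain with center $x_0$ and constant $\kappa_0$. Let $H:\overline\Omega\times\mathbb R^n\to\mathbb R$ and set $C=\{(x,p)\in\overline\Omega\times\mathbb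 R^n: H(x,p)\le0\}$, $C_x=\{p: H(x,p)\le 0\}$. Assume that $C$ is closed; that every $C_x$ is convex; that for all $(x,p)\in C$ and $\delta>0$ there is $p_\delta$ with $|p-p_\delta|\le\delta$ and $(x,p_\delta)$ in the interior of $C$ relative to $\overline\Omega\times\mathbb R^n$; that for all $(x,p)\in\overline\Omega\times\mathbb R^n$ one has $H(x,p)<0$ if and only if $p/\lambda\in C_x$ for some $\lambda\in(0,1)$; and that $B_{\sigma_*}(0)\subset C_x\subset B_{\sigma^*}(0)$ for all $x\in\overline\Omega$, where $0<\sigma_*\le\sigma^*$. Put $\sigma(x,q)=\sup\{q\cdot p: p\in C_x\}$ and, for $x\in\overline\Omega$, $$v(x)=\inf\Big\{\int_0^1\sigma(\gamma(s),\gamma'(s))\,ds\ :\ \gamma:[0,1]\to\overline\Omega\ \text{Lipschitz},\ \gamma(0)\in\overline{V_0},\ \gamma(1)=x\Big\},\qquad V(t)=\{x\in\overline\Omega: v(x)<t\}.$$ **Proposition.** The following hold. 1. For every $T>0$ there is $\kappa(T)\in(0,1]$ such that, for all $t\in(0,T]$, $V(t)$ is a John domain with center $x_0$ and constant $\kappa(T)$.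 Here $\kappa(T)$ depends only on $n$, $\sigma_*$, $\sigma^*$, $\bar\varepsilon$, $\kappa_0$, $d(x_0,\partial\Omega)$ and $T$, and $\kappa(T)\to0$ as $T\to\infty$. (If $\Omega=\mathbb R^n$, the datum $d(x_0,\partial\Omega)$ is void.) 2. The Hausdorff distance satisfies $d_H(V(t),V(s))\le\frac1{\sigma_*}(t-s)$ for all $0<s\le t$. 3. For every $T>0$ there are $\mu(T)\in(0,1)$ and $c_H(T)>0$ such that $$|V(t)\setminus V(s)|\le c_H(T)\,(t-s)^{\mu(T)}\qquad\text{for all }0<s\le t\le T.$$ Here $\mu(T)$ depends on the same quantities as $\kappa(T)$, and so does $c_H(T)$ if $\Omega\neq\mathbb R^n$; if $\Omega=\mathbb R^n$, $c_H(T)$ may depend in addition on $d(x_0,\partial V_0)$. -/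

import Mathlib

open Set Filter Topology MeasureTheory

noncomputable section

namespace AccretiveGrowth

variable {n : ℕ}

/-- An open set has `C^{1,1}` boundary if near each boundary point, in suitable orthonormal
coordinates with last axis `e`, it is the set lying strictly below the graph of a function `φ` of
the coordinates orthogonal to `e` whose gradient is Lipschitz continuous. -/
def HasC11Boundary (Ω : Set (EuclideanSpace ℝ (Fin n))) : Prop :=
  ∀ x ∈ frontier Ω, ∃ r > (0 : ℝ), ∃ e : EuclideanSpace ℝ (Fin n), ‖e‖ = 1 ∧
    ∃ φ : EuclideanSpace ℝ (Fin n) → ℝ,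
      Differentiable ℝ φ ∧ (∃ M : NNReal, LipschitzWith M (fderiv ℝ φ)) ∧
      ∀ y ∈ Metric.ball x r,
        (y ∈ Ω ↔ inner ℝ (y - x) e < φ ((y - x) - (inner ℝ (y - x) e : ℝ) • e))

/-- Every boundary point is touched by an interior and by an exterior ball of radius `ε`. -/
def HasTouchingBalls (Ω : Set (EuclideanSpace ℝ (Fin n))) (ε : ℝ) : Prop :=
  ∀ x ∈ frontier Ω, ∃ xi xe : EuclideanSpace ℝ (Fin n),
    Metric.ball xi ε ⊆ Ω ∧ Metric.ball xe ε ⊆ (closure Ω)ᶜ ∧ dist x xi = ε ∧ dist x xe = ε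

/-- Lipschitz (that is, `W^{1,∞}`) curves `[0,1] → A`. The values of `γ` outside `[0,1]` are
irrelevant. -/
def IsLipCurve (A : Set (EuclideanSpace ℝ (Fin n))) (γ : ℝ → EuclideanSpace ℝ (Fin n)) : Prop :=
  (∃ K : NNReal, LipschitzOnWith K γ (Icc 0 1)) ∧ MapsTo γ (Icc 0 1) A

/-- The geodesic distance in `A`: the infimum of the lengths of Lipschitz curves in `A` from `y`
to `x` (infinite if there is none). -/
def geodesicDist (A : Set (EuclideanSpace ℝ (Fin n))) (x y : EuclideanSpace ℝ (Fin n)) : ENNReal :=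
  ⨅ (γ : ℝ → EuclideanSpace ℝ (Fin n)) (_ : IsLipCurve A γ ∧ γ 0 = y ∧ γ 1 = x),
    ∫⁻ s in Icc (0 : ℝ) 1, ‖deriv γ s‖ₑ

/-- `U` is a John domain with John center `x₀` and John constant `κ`. The set `U` is bounded, but
not required to be open. -/
def IsJohnDomain (U : Set (EuclideanSpace ℝ (Fin n))) (x₀ : EuclideanSpace ℝ (Fin n)) (κ : ℝ) :
    Prop :=
  Bornology.IsBounded U ∧ x₀ ∈ U ∧ 0 < κ ∧ κ ≤ 1 ∧
  ∀ x ∈ U, ∃ l : ℝ, 0 ≤ l ∧ ∃ γ : ℝ → EuclideanSpace ℝ (Fin n),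
    HasUnitSpeedOn γ (Icc 0 l) ∧ MapsTo γ (Icc 0 l) U ∧ γ 0 = x ∧ γ l = x₀ ∧
    ∀ s ∈ Icc 0 l, κ * s ≤ Metric.infDist (γ s) (frontier U)

/-- The assumptions on the constraining set `Ω`: nonempty, open, connected, of class `C^{1,1}`,
and with geodesic distance of the closure comparable to the Euclidean distance. -/
structure IsConstrainingSet (Ω : Set (EuclideanSpace ℝ (Fin n))) : Prop where
  isOpen : IsOpen Ω
  isConnected : IsConnected Ω
  c11 : HasC11Boundary Ω
  geodesic_le : ∃ L > (0 : ℝ), ∀ x ∈ closure Ω, ∀ y ∈ closure Ω,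
    geodesicDist (closure Ω) x y ≤ ENNReal.ofReal (L * dist x y)

/-- The assumptions on the Hamiltonian `H`, of which only the values `H x p` with `x` in the
closure of `Ω` matter. The interior in `approx` is relative to `closure Ω × ℝⁿ`. -/
structure IsHamiltonian (Ω : Set (EuclideanSpace ℝ (Fin n)))
    (H : EuclideanSpace ℝ (Fin n) → EuclideanSpace ℝ (Fin n) → ℝ) (σl σu : ℝ) : Prop where
  isClosed : IsClosed {z : EuclideanSpace ℝ (Fin n) × EuclideanSpace ℝ (Fin n) |
    z.1 ∈ closure Ω ∧ H z.1 z.2 ≤ 0}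
  convex : ∀ x ∈ closure Ω, Convex ℝ {p | H x p ≤ 0}
  approx : ∀ x ∈ closure Ω, ∀ p, H x p ≤ 0 → ∀ δ > (0 : ℝ), ∃ p', ‖p - p'‖ ≤ δ ∧
    {z : EuclideanSpace ℝ (Fin n) × EuclideanSpace ℝ (Fin n) | H z.1 z.2 ≤ 0} ∈
      𝓝[closure Ω ×ˢ univ] (x, p')
  neg_iff : ∀ x ∈ closure Ω, ∀ p, H x p < 0 ↔ ∃ t ∈ Ioo (0 : ℝ) 1, H x (t⁻¹ • p) ≤ 0
  pos : 0 < σl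
  le : σl ≤ σu
  ball_subset : ∀ x ∈ closure Ω, Metric.ball 0 σl ⊆ {p | H x p ≤ 0}
  subset_ball : ∀ x ∈ closure Ω, {p | H x p ≤ 0} ⊆ Metric.ball 0 σu

/-- The support function `σ(x, ·)` of the sublevel `{p | H(x, p) ≤ 0}`. -/
def supportFun (H : EuclideanSpace ℝ (Fin n) → EuclideanSpace ℝ (Fin n) → ℝ)
    (x q : EuclideanSpace ℝ (Fin n)) : ℝ :=
  sSup ((fun p => (inner ℝ q p : ℝ)) '' {p | H x p ≤ 0})

/-- The value function given by the constrained representation formula: the least cost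
`∫₀¹ σ(γ, γ') ds` of a Lipschitz curve in the closure of `Ω` that leads from the closure of `V₀`
to `x`. -/
def attachmentTime (H : EuclideanSpace ℝ (Fin n) → EuclideanSpace ℝ (Fin n) → ℝ)
    (Ω V₀ : Set (EuclideanSpace ℝ (Fin n))) (x : EuclideanSpace ℝ (Fin n)) : ℝ :=
  sInf {a | ∃ γ : ℝ → EuclideanSpace ℝ (Fin n),
    IsLipCurve (closure Ω) γ ∧ γ 0 ∈ closure V₀ ∧ γ 1 = x ∧
    a = ∫ s in (0 : ℝ)..1, supportFun H (γ s) (deriv γ s)}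

/-- The sublevel `V(t)` of the value function in the closure of `Ω`. -/
def growingSet (H : EuclideanSpace ℝ (Fin n) → EuclideanSpace ℝ (Fin n) → ℝ)
    (Ω V₀ : Set (EuclideanSpace ℝ (Fin n))) (t : ℝ) : Set (EuclideanSpace ℝ (Fin n)) :=
  {x | x ∈ closure Ω ∧ attachmentTime H Ω V₀ x < t}

end AccretiveGrowth

end

noncomputable section

namespace AccretiveGrowth

variable {n : ℕ}

local notation "𝔼" n:max => EuclideanSpace ℝ (Fin n)

/-! ### Curves -/

/-! The bounds `σl * ‖q‖ ≤ supportFun H x q ≤ σu * ‖q‖` make `v` a travel time. A nearly optimal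
curve, parametrized by its cost, leads from every `x` with `v x < t` back to the closure of `V₀`,
lowering the bound on `v` by at least `σl` per unit of length, while `v` grows by at most `σu` per
unit of length along segments in the closure of `Ω`. `IsTravelTime` records these facts, and
everything else follows from them, the touching balls and the John property of `V₀`.

Hausdorff distance: walk back along the curve by cost `t - s`.

John property: after length `s` on the way back, `v` leaves room `σl * s`, so a ball of radius
comparable to `s` is affordable in time. The curve may run along the frontier of `Ω`, so it is
replaced by a polygon through points pushed inwards to depth `θ * min s m`. Interior balls allow the
pushing (`exists_inward_path`). Exterior balls keep the segments between pushed points inside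
(`ball_subset_of_mem_segment`). Near the closure of `V₀` the polygon is joined to a John curve of
`V₀` (`exists_carrotPath_center`).

Volume: for `ρ` between a multiple of `t - s` and a fixed scale, the ball of radius `ρ` around a
point of `V(t) \ V(s)` contains a ball of comparable radius inside `V(s)` (`exists_ball_disjoint`).
The difference is thus porous on these scales. Its neighborhoods lose a fixed fraction of volume
each time the scale shrinks by the factor `c` (`volume_thickening_add_le`), and iteration gives a
power of `t - s` (`volume_le_of_porous`). -/

theorem lipschitzOnWith_Icc_append {X : Type*} [PseudoMetricSpace X] {f : ℝ → X} {K : NNReal}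
    {a b c : ℝ} (h₁ : LipschitzOnWith K f (Icc a b)) (h₂ : LipschitzOnWith K f (Icc b c)) :
    LipschitzOnWith K f (Icc a c) := by
  have key : ∀ x ∈ Icc a c, ∀ y ∈ Icc a c, x ≤ y → dist (f x) (f y) ≤ K * dist x y := by
    intro x hx y hy hxy
    rcases le_total y b with hyb | hby
    · exact h₁.dist_le_mul x ⟨hx.1, hxy.trans hyb⟩ y ⟨hy.1, hyb⟩
    rcases le_total b x with hbx | hxb
    · exact h₂.dist_le_mul x ⟨hbx, hx.2⟩ y ⟨hbx.trans hxy, hy.2⟩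
    have e₁ := h₁.dist_le_mul x ⟨hx.1, hxb⟩ b ⟨hx.1.trans hxb, le_rfl⟩
    have e₂ := h₂.dist_le_mul b ⟨le_rfl, hby.trans hy.2⟩ y ⟨hby, hy.2⟩
    have e₃ : dist x y = dist x b + dist b y := by
      rw [Real.dist_eq, Real.dist_eq, Real.dist_eq, abs_sub_comm x y, abs_sub_comm x b,
        abs_sub_comm b y, abs_of_nonneg (by linarith), abs_of_nonneg (by linarith),
        abs_of_nonneg (by linarith)]
      ring
    calc dist (f x) (f y) ≤ dist (f x) (f b) + dist (f b) (f y) := dist_triangle _ _ _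
      _ ≤ K * dist x b + K * dist b y := add_le_add e₁ e₂
      _ = K * dist x y := by rw [e₃]; ring
  refine LipschitzOnWith.of_dist_le_mul fun x hx y hy => ?_
  rcases le_total x y with h | h
  · exact key x hx y hy h
  · rw [dist_comm (f x), dist_comm x]
    exact key y hy x hx h

theorem ae_differentiableAt_of_lipschitzOnWith {γ : ℝ → 𝔼 n} {K : NNReal} {a b : ℝ}
    (h : LipschitzOnWith K γ (Icc a b)) :
    ∀ᵐ s ∂volume.restrict (Ioc a b), DifferentiableAt ℝ γ s := by
  rw [← restrict_Ioo_eq_restrict_Ioc, ae_restrict_iff' measurableSet_Ioo]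
  filter_upwards [(h.mono Ioo_subset_Icc_self).ae_differentiableWithinAt_of_mem (μ := volume)]
    with s hs hmem
  exact (hs hmem).differentiableAt (isOpen_Ioo.mem_nhds hmem)

theorem norm_deriv_le_of_lipschitzOnWith_Icc {γ : ℝ → 𝔼 n} {K : NNReal} {a b s : ℝ}
    (h : LipschitzOnWith K γ (Icc a b)) (hs : s ∈ Ioo a b) : ‖deriv γ s‖ ≤ K :=
  norm_deriv_le_of_lipschitzOn (Icc_mem_nhds hs.1 hs.2) h

theorem intervalIntegrable_of_norm_le {f : ℝ → ℝ} {a b C : ℝ} (hab : a ≤ b)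
    (hf : AEStronglyMeasurable f (volume.restrict (Ioc a b))) (hC : ∀ s ∈ Ioo a b, |f s| ≤ C) :
    IntervalIntegrable f volume a b := by
  rw [intervalIntegrable_iff_integrableOn_Ioc_of_le hab]
  refine Integrable.of_bound hf C ?_
  rw [← restrict_Ioo_eq_restrict_Ioc]
  exact (ae_restrict_iff' measurableSet_Ioo).2 (ae_of_all _ hC)

/-- Testing against the chord `e = γ b - γ a` reduces the claim to the fundamental theorem of
calculus for an absolutely continuous scalar function and to Cauchy-Schwarz. -/
theorem dist_le_integral_norm_deriv {γ : ℝ → 𝔼 n} {K : NNReal} {a b : ℝ} (hab : a ≤ b)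
    (h : LipschitzOnWith K γ (Icc a b)) : dist (γ a) (γ b) ≤ ∫ s in a..b, ‖deriv γ s‖ := by
  set e := γ b - γ a with he
  have hint : IntervalIntegrable (fun s => ‖deriv γ s‖) volume a b :=
    intervalIntegrable_of_norm_le (C := K) hab (measurable_deriv γ).norm.aestronglyMeasurable
      fun s hs => by
        rw [abs_norm]
        exact norm_deriv_le_of_lipschitzOnWith_Icc h hs
  have hl : LipschitzOnWith (‖innerSL ℝ e‖₊ * K) (fun s => innerSL ℝ e (γ s)) (uIcc a b) := by
    rw [uIcc_of_le hab]
    exact (innerSL ℝ e).lipschitz.comp_lipschitzOnWith h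
  have h1 := hl.absolutelyContinuousOnInterval.integral_deriv_eq_sub
  have h2 : ∫ s in a..b, deriv (fun s => innerSL ℝ e (γ s)) s ≤ ∫ s in a..b, ‖e‖ * ‖deriv γ s‖ := by
    refine intervalIntegral.integral_mono_ae_restrict hab
      hl.absolutelyContinuousOnInterval.intervalIntegrable_deriv (hint.const_mul _) ?_
    rw [← restrict_Ioc_eq_restrict_Icc]
    filter_upwards [ae_differentiableAt_of_lipschitzOnWith h] with s hs
    have := ((innerSL ℝ e).hasFDerivAt.comp_hasDerivAt s hs.hasDerivAt).deriv
    simp only [Function.comp_def] at this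
    rw [this]
    exact real_inner_le_norm e (deriv γ s)
  rw [h1, intervalIntegral.integral_const_mul, ← map_sub, ← he] at h2
  simp only [innerSL_apply_apply, real_inner_self_eq_norm_mul_norm] at h2
  rw [dist_comm, dist_eq_norm, ← he]
  rcases (norm_nonneg e).eq_or_lt with h0 | h0
  · rw [← h0]
    exact intervalIntegral.integral_nonneg hab fun s _ => norm_nonneg _
  · exact le_of_mul_le_mul_left h2 h0

/-! ### The support function -/

section supportFun

variable {Ω : Set (𝔼 n)} {H : 𝔼 n → 𝔼 n → ℝ} {σl σu : ℝ} {x : 𝔼 n}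

theorem IsHamiltonian.zero_mem (hH : IsHamiltonian Ω H σl σu) (hx : x ∈ closure Ω) :
    H x 0 ≤ 0 := hH.ball_subset x hx (Metric.mem_ball_self hH.pos)

theorem IsHamiltonian.upper_pos (hH : IsHamiltonian Ω H σl σu) : 0 < σu := hH.pos.trans_le hH.le

theorem IsHamiltonian.inner_le (hH : IsHamiltonian Ω H σl σu) (hx : x ∈ closure Ω) (q : 𝔼 n) {p : 𝔼 n}
    (hp : H x p ≤ 0) : (inner ℝ q p : ℝ) ≤ σu * ‖q‖ := by
  have h1 : ‖p‖ ≤ σu := (mem_ball_zero_iff.1 (hH.subset_ball x hx hp)).le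
  have h2 := real_inner_le_norm q p
  nlinarith [norm_nonneg q]

theorem IsHamiltonian.bddAbove (hH : IsHamiltonian Ω H σl σu) (hx : x ∈ closure Ω) (q : 𝔼 n) :
    BddAbove ((fun p => (inner ℝ q p : ℝ)) '' {p | H x p ≤ 0}) := by
  refine ⟨σu * ‖q‖, ?_⟩
  rintro _ ⟨p, hp, rfl⟩
  exact hH.inner_le hx q hp

theorem IsHamiltonian.supportFun_le (hH : IsHamiltonian Ω H σl σu) (hx : x ∈ closure Ω) (q : 𝔼 n) :
    supportFun H x q ≤ σu * ‖q‖ := by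
  refine csSup_le ⟨_, 0, hH.zero_mem hx, rfl⟩ ?_
  rintro _ ⟨p, hp, rfl⟩
  exact hH.inner_le hx q hp

theorem IsHamiltonian.le_supportFun (hH : IsHamiltonian Ω H σl σu) (hx : x ∈ closure Ω) (q : 𝔼 n) :
    σl * ‖q‖ ≤ supportFun H x q := by
  rcases eq_or_ne q 0 with rfl | hq
  · rw [norm_zero, mul_zero]
    exact le_csSup (hH.bddAbove hx 0) ⟨0, hH.zero_mem hx, by simp⟩
  have hq' : 0 < ‖q‖ := norm_pos_iff.2 hq
  refine le_of_forall_lt_imp_le_of_dense fun a ha => ?_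
  rcases le_or_gt a 0 with h0 | h0
  · exact h0.trans (le_csSup (hH.bddAbove hx q) ⟨0, hH.zero_mem hx, by simp⟩)
  -- The ball of radius `σl` is open, so the competitor is parallel to `q`, strictly shorter than
  -- `σl`, and has inner product exactly `a` with `q`.
  refine le_csSup (hH.bddAbove hx q) ⟨(a / ‖q‖ ^ 2) • q, hH.ball_subset x hx ?_, ?_⟩
  · rw [mem_ball_zero_iff, norm_smul, Real.norm_of_nonneg (by positivity)]
    rw [show a / ‖q‖ ^ 2 * ‖q‖ = a / ‖q‖ by field_simp, div_lt_iff₀ hq']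
    exact ha
  · simp only [inner_smul_right, real_inner_self_eq_norm_sq]
    field_simp

theorem IsHamiltonian.supportFun_nonneg (hH : IsHamiltonian Ω H σl σu) (hx : x ∈ closure Ω)
    (q : 𝔼 n) : 0 ≤ supportFun H x q :=
  (mul_nonneg hH.pos.le (norm_nonneg q)).trans (hH.le_supportFun hx q)

theorem supportFun_smul (H : 𝔼 n → 𝔼 n → ℝ) (x q : 𝔼 n) {a : ℝ} (ha : 0 ≤ a) :
    supportFun H x (a • q) = a * supportFun H x q := by
  rw [supportFun, supportFun, ← smul_eq_mul, ← Real.sSup_smul_of_nonneg ha, ← image_smul,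
    image_image]
  congr 1
  refine image_congr fun p _ => ?_
  rw [real_inner_smul_left, smul_eq_mul]

theorem IsHamiltonian.isCompact (hH : IsHamiltonian Ω H σl σu) (hx : x ∈ closure Ω) :
    IsCompact {p | H x p ≤ 0} := by
  refine Metric.isCompact_of_isClosed_isBounded ?_
    (Metric.isBounded_ball.subset (hH.subset_ball x hx))
  have := hH.isClosed.preimage (f := fun p : 𝔼 n => (x, p)) (by fun_prop)
  rwa [show (fun p : 𝔼 n => (x, p)) ⁻¹' _ = {p | H x p ≤ 0} by ext p; simp [hx]] at this

/-- The supremum is attained, so a superlevel is the projection of a closed set along a compact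
ball, hence closed. This yields the joint measurability that makes the cost integrals meaningful. -/
theorem IsHamiltonian.upperSemicontinuous (hH : IsHamiltonian Ω H σl σu) :
    UpperSemicontinuous fun z : closure Ω × 𝔼 n => supportFun H z.1 z.2 := by
  rw [upperSemicontinuous_iff_isClosed_preimage]
  intro a
  have hK : CompactSpace (Metric.closedBall (0 : 𝔼 n) σu) :=
    isCompact_iff_compactSpace.1 (isCompact_closedBall 0 σu)
  have hcl : IsClosed {w : Metric.closedBall (0 : 𝔼 n) σu × (closure Ω × 𝔼 n) |
      H w.2.1 w.1 ≤ 0 ∧ a ≤ inner ℝ w.2.2 (w.1 : 𝔼 n)} := by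
    have hin : IsClosed {w : Metric.closedBall (0 : 𝔼 n) σu × (closure Ω × 𝔼 n) |
        a ≤ inner ℝ w.2.2 (w.1 : 𝔼 n)} := isClosed_le continuous_const (by fun_prop)
    refine IsClosed.inter ?_ hin
    have := hH.isClosed.preimage
      (f := fun w : Metric.closedBall (0 : 𝔼 n) σu × (closure Ω × 𝔼 n) => ((w.2.1 : 𝔼 n), (w.1 : 𝔼 n)))
      (by fun_prop)
    rwa [show (fun w : Metric.closedBall (0 : 𝔼 n) σu × (closure Ω × 𝔼 n) =>
      ((w.2.1 : 𝔼 n), (w.1 : 𝔼 n))) ⁻¹' _ = {w | H w.2.1 w.1 ≤ 0} by ext w; simp] at this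
  convert isClosedMap_snd_of_compactSpace _ hcl using 1
  ext ⟨y, q⟩
  simp only [mem_preimage, mem_Ici, mem_image, mem_ofPred_eq, Prod.exists, Subtype.exists,
    exists_eq_right, Metric.mem_closedBall, dist_zero_right]
  constructor
  · intro h
    obtain ⟨p, hp, he⟩ := (hH.isCompact y.2).exists_sSup_image_eq ⟨0, hH.zero_mem y.2⟩
      (f := fun p => (inner ℝ q p : ℝ)) (by fun_prop)
    exact ⟨p, (mem_ball_zero_iff.1 (hH.subset_ball _ y.2 hp)).le, hp, he ▸ h⟩
  · rintro ⟨p, -, hp, h⟩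
    exact h.trans (le_csSup (hH.bddAbove y.2 q) ⟨p, hp, rfl⟩)

end supportFun

/-! ### The value function -/

section value

variable {Ω V₀ : Set (𝔼 n)} {H : 𝔼 n → 𝔼 n → ℝ} {σl σu : ℝ} {x y : 𝔼 n} {γ : ℝ → 𝔼 n}

theorem IsHamiltonian.measurable_supportFun (hH : IsHamiltonian Ω H σl σu) :
    Measurable fun z : closure Ω × 𝔼 n => supportFun H z.1 z.2 :=
  hH.upperSemicontinuous.measurable

theorem IsLipCurve.exists_continuous {A : Set (𝔼 n)} (hγ : IsLipCurve A γ) :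
    ∃ γ' : ℝ → A, Continuous γ' ∧ ∀ s ∈ Icc (0 : ℝ) 1, (γ' s : 𝔼 n) = γ s := by
  obtain ⟨⟨K, hK⟩, hm⟩ := hγ
  refine ⟨fun s => ⟨γ (projIcc (0 : ℝ) 1 zero_le_one s), hm (projIcc (0 : ℝ) 1 zero_le_one s).2⟩,
    Continuous.subtype_mk ?_ _, fun s hs => by simp only [projIcc_of_mem zero_le_one hs]⟩
  exact hK.continuousOn.comp_continuous (continuous_subtype_val.comp continuous_projIcc)
    fun s => (projIcc (0 : ℝ) 1 zero_le_one s).2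

theorem IsHamiltonian.aestronglyMeasurable_cost (hH : IsHamiltonian Ω H σl σu)
    (hγ : IsLipCurve (closure Ω) γ) :
    AEStronglyMeasurable (fun s => supportFun H (γ s) (deriv γ s)) (volume.restrict (Ioc 0 1)) := by
  obtain ⟨γ', hc, hγ'⟩ := hγ.exists_continuous
  have hmeas : Measurable fun s => supportFun H (γ' s) (deriv γ s) := by
    have := hH.measurable_supportFun.comp (hc.measurable.prodMk (measurable_deriv γ))
    simpa only [Function.comp_def] using this
  refine hmeas.aestronglyMeasurable.congr ?_
  refine (ae_restrict_iff' measurableSet_Ioc).2 (ae_of_all _ fun s hs => ?_)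
  simp only [hγ' s (Ioc_subset_Icc_self hs)]

theorem IsHamiltonian.intervalIntegrable_cost (hH : IsHamiltonian Ω H σl σu)
    (hγ : IsLipCurve (closure Ω) γ) :
    IntervalIntegrable (fun s => supportFun H (γ s) (deriv γ s)) volume 0 1 := by
  obtain ⟨K, hK⟩ := hγ.1
  refine intervalIntegrable_of_norm_le (C := σu * K) zero_le_one
    (hH.aestronglyMeasurable_cost hγ) fun s hs => ?_
  have hx := hγ.2 (Ioo_subset_Icc_self hs)
  rw [abs_of_nonneg (hH.supportFun_nonneg hx _)]
  exact (hH.supportFun_le hx _).trans (mul_le_mul_of_nonneg_left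
    (norm_deriv_le_of_lipschitzOnWith_Icc hK hs) hH.upper_pos.le)

theorem IsHamiltonian.intervalIntegrable_cost_of_le (hH : IsHamiltonian Ω H σl σu)
    (hγ : IsLipCurve (closure Ω) γ) {a b : ℝ} (ha : 0 ≤ a) (hab : a ≤ b) (hb : b ≤ 1) :
    IntervalIntegrable (fun s => supportFun H (γ s) (deriv γ s)) volume a b := by
  refine (hH.intervalIntegrable_cost hγ).mono_set ?_
  rw [uIcc_of_le hab, uIcc_of_le zero_le_one]
  exact Icc_subset_Icc ha hb

theorem IsHamiltonian.mul_dist_le_cost (hH : IsHamiltonian Ω H σl σu)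
    (hγ : IsLipCurve (closure Ω) γ) {a b : ℝ} (ha : 0 ≤ a) (hab : a ≤ b) (hb : b ≤ 1) :
    σl * dist (γ a) (γ b) ≤ ∫ s in a..b, supportFun H (γ s) (deriv γ s) := by
  obtain ⟨K, hK⟩ := hγ.1
  have hK' : LipschitzOnWith K γ (Icc a b) := hK.mono (Icc_subset_Icc ha hb)
  have hint : IntervalIntegrable (fun s => ‖deriv γ s‖) volume a b :=
    intervalIntegrable_of_norm_le (C := K) hab (measurable_deriv γ).norm.aestronglyMeasurable
      fun s hs => by
        rw [abs_norm]
        exact norm_deriv_le_of_lipschitzOnWith_Icc hK' hs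
  calc σl * dist (γ a) (γ b) ≤ σl * ∫ s in a..b, ‖deriv γ s‖ :=
        mul_le_mul_of_nonneg_left (dist_le_integral_norm_deriv hab hK') hH.pos.le
    _ = ∫ s in a..b, σl * ‖deriv γ s‖ := (intervalIntegral.integral_const_mul _ _).symm
    _ ≤ _ := intervalIntegral.integral_mono_on hab (hint.const_mul _)
        (hH.intervalIntegrable_cost_of_le hγ ha hab hb) fun s hs =>
          hH.le_supportFun (hγ.2 ⟨ha.trans hs.1, hs.2.trans hb⟩) _

theorem IsHamiltonian.cost_nonneg (hH : IsHamiltonian Ω H σl σu)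
    (hγ : IsLipCurve (closure Ω) γ) {a b : ℝ} (ha : 0 ≤ a) (hab : a ≤ b) (hb : b ≤ 1) :
    0 ≤ ∫ s in a..b, supportFun H (γ s) (deriv γ s) :=
  (mul_nonneg hH.pos.le dist_nonneg).trans (hH.mul_dist_le_cost hγ ha hab hb)

theorem IsHamiltonian.attachmentTime_le (hH : IsHamiltonian Ω H σl σu)
    (hγ : IsLipCurve (closure Ω) γ) (h0 : γ 0 ∈ closure V₀) :
    attachmentTime H Ω V₀ (γ 1) ≤ ∫ s in (0 : ℝ)..1, supportFun H (γ s) (deriv γ s) := by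
  refine csInf_le ⟨0, ?_⟩ ⟨γ, hγ, h0, rfl, rfl⟩
  rintro _ ⟨γ', hγ', -, -, rfl⟩
  exact hH.cost_nonneg hγ' le_rfl zero_le_one le_rfl

theorem IsHamiltonian.attachmentTime_nonneg (hH : IsHamiltonian Ω H σl σu) (V₀ : Set (𝔼 n))
    (x : 𝔼 n) : 0 ≤ attachmentTime H Ω V₀ x := by
  refine Real.sInf_nonneg ?_
  rintro _ ⟨γ', hγ', -, -, rfl⟩
  exact hH.cost_nonneg hγ' le_rfl zero_le_one le_rfl

/-- Positive homogeneity of the support function makes the cost independent of the parametrization.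
-/
theorem integral_cost_comp_mul (H : 𝔼 n → 𝔼 n → ℝ) (γ : ℝ → 𝔼 n) {τ b : ℝ} (hτ : 0 ≤ τ) :
    ∫ s in (0 : ℝ)..b, supportFun H (γ (τ * s)) (deriv (fun r => γ (τ * r)) s) =
      ∫ s in (0 : ℝ)..τ * b, supportFun H (γ s) (deriv γ s) := by
  have h := intervalIntegral.mul_integral_comp_mul_left (a := 0) (b := b)
    (f := fun s => supportFun H (γ s) (deriv γ s)) τ
  rw [mul_zero] at h
  rw [← h, ← intervalIntegral.integral_const_mul]
  congr 1
  ext s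
  rw [deriv_comp_mul_left, supportFun_smul _ _ _ hτ]

theorem IsHamiltonian.attachmentTime_le_of_mem (hH : IsHamiltonian Ω H σl σu)
    (hγ : IsLipCurve (closure Ω) γ) (h0 : γ 0 ∈ closure V₀) {τ : ℝ} (hτ : τ ∈ Icc (0 : ℝ) 1) :
    attachmentTime H Ω V₀ (γ τ) ≤ ∫ s in (0 : ℝ)..τ, supportFun H (γ s) (deriv γ s) := by
  have hmaps : MapsTo (fun s => τ * s) (Icc (0 : ℝ) 1) (Icc 0 1) := fun s hs =>
    ⟨mul_nonneg hτ.1 hs.1, mul_le_one₀ hτ.2 hs.1 hs.2⟩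
  have hl : IsLipCurve (closure Ω) fun s => γ (τ * s) := by
    obtain ⟨K, hK⟩ := hγ.1
    refine ⟨⟨K * 1, hK.comp (LipschitzOnWith.of_dist_le_mul fun a _ b _ => ?_) hmaps⟩,
      hγ.2.comp hmaps⟩
    rw [Real.dist_eq, Real.dist_eq, ← mul_sub, abs_mul, abs_of_nonneg hτ.1]
    exact mul_le_mul_of_nonneg_right hτ.2 (abs_nonneg _)
  have := hH.attachmentTime_le (V₀ := V₀) hl (by simpa using h0)
  rwa [integral_cost_comp_mul H γ hτ.1, mul_one] at this

theorem IsHamiltonian.attachmentTime_eq_zero (hH : IsHamiltonian Ω H σl σu) (hV : V₀ ⊆ Ω)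
    (hx : x ∈ closure V₀) : attachmentTime H Ω V₀ x = 0 := by
  refine le_antisymm ?_ (hH.attachmentTime_nonneg V₀ x)
  have hl : IsLipCurve (closure Ω) fun _ => x :=
    ⟨⟨0, (LipschitzWith.const x).lipschitzOnWith⟩, fun _ _ => closure_mono hV hx⟩
  refine (hH.attachmentTime_le hl hx).trans_eq ?_
  have : supportFun H x 0 = 0 := by simpa using supportFun_smul H x 0 le_rfl
  simp [this]

theorem exists_curve_of_attachmentTime_lt (hΩ : IsConstrainingSet Ω) (hV : V₀ ⊆ Ω)
    (hne : V₀.Nonempty) (hx : x ∈ closure Ω) {t : ℝ} (ht : attachmentTime H Ω V₀ x < t) :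
    ∃ γ, IsLipCurve (closure Ω) γ ∧ γ 0 ∈ closure V₀ ∧ γ 1 = x ∧
      ∫ s in (0 : ℝ)..1, supportFun H (γ s) (deriv γ s) < t := by
  -- The infimum of the empty set is `0` by convention, so a competitor must exist first. Finiteness
  -- of the geodesic distance provides one.
  have hex : ∃ γ, IsLipCurve (closure Ω) γ ∧ γ 0 ∈ closure V₀ ∧ γ 1 = x := by
    obtain ⟨y, hy⟩ := hne
    obtain ⟨L, -, hL⟩ := hΩ.geodesic_le
    have := (hL x hx y (subset_closure (hV hy))).trans_lt ENNReal.ofReal_lt_top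
    obtain ⟨γ, hγ⟩ := iInf_lt_iff.1 this
    obtain ⟨⟨h₁, h₂, h₃⟩, -⟩ := iInf_lt_iff.1 hγ
    exact ⟨γ, h₁, h₂ ▸ subset_closure hy, h₃⟩
  obtain ⟨γ, h₁, h₂, h₃⟩ := hex
  obtain ⟨_, ⟨γ', h₁, h₂, h₃, rfl⟩, hlt⟩ :=
    exists_lt_of_csInf_lt (by exact ⟨_, γ, h₁, h₂, h₃, rfl⟩) ht
  exact ⟨γ', h₁, h₂, h₃, hlt⟩

/-- The new parameter is the accumulated cost `F`. It need not be injective, but by the lower bound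
on the cost `γ` is constant where `F` is, so any choice of preimages under `F` works. -/
theorem IsHamiltonian.exists_backtrack (hH : IsHamiltonian Ω H σl σu) (hΩ : IsConstrainingSet Ω)
    (hV : V₀ ⊆ Ω) (hne : V₀.Nonempty) (hx : x ∈ closure Ω) {t : ℝ}
    (ht : attachmentTime H Ω V₀ x < t) :
    ∃ (a : ℝ) (β : ℝ → 𝔼 n), 0 ≤ a ∧ a < t ∧
      (∀ c ∈ Icc 0 a, β c ∈ closure Ω ∧ attachmentTime H Ω V₀ (β c) ≤ c) ∧
      (∀ c ∈ Icc 0 a, ∀ c' ∈ Icc 0 a, σl * dist (β c) (β c') ≤ |c - c'|) ∧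
      β 0 ∈ closure V₀ ∧ β a = x := by
  obtain ⟨γ, hγ, h0, h1, hlt⟩ := exists_curve_of_attachmentTime_lt hΩ hV hne hx ht
  set F : ℝ → ℝ := fun τ => ∫ s in (0 : ℝ)..τ, supportFun H (γ s) (deriv γ s) with hF
  have hFd : ∀ c ∈ Icc (0 : ℝ) 1, ∀ c' ∈ Icc (0 : ℝ) 1,
      σl * dist (γ c) (γ c') ≤ |F c - F c'| := by
    have key : ∀ c ∈ Icc (0 : ℝ) 1, ∀ c' ∈ Icc (0 : ℝ) 1, c ≤ c' →
        σl * dist (γ c) (γ c') ≤ |F c - F c'| := by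
      intro c hc c' hc' hcc
      rw [abs_sub_comm, hF]
      simp only
      rw [intervalIntegral.integral_interval_sub_left
        (hH.intervalIntegrable_cost_of_le hγ le_rfl hc'.1 hc'.2)
        (hH.intervalIntegrable_cost_of_le hγ le_rfl hc.1 hc.2)]
      exact (hH.mul_dist_le_cost hγ hc.1 hcc hc'.2).trans (le_abs_self _)
    intro c hc c' hc'
    rcases le_total c c' with h | h
    · exact key c hc c' hc' h
    · rw [dist_comm, abs_sub_comm]
      exact key c' hc' c hc h
  have hF0 : F 0 = 0 := intervalIntegral.integral_same
  have hcont : ContinuousOn F (Icc 0 1) := by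
    have := intervalIntegral.continuousOn_primitive_interval
      (f := fun s => supportFun H (γ s) (deriv γ s)) (μ := volume) (a := 0) (b := 1) ?_
    · rwa [uIcc_of_le zero_le_one] at this
    · rw [uIcc_of_le zero_le_one, integrableOn_Icc_iff_integrableOn_Ioc]
      exact (intervalIntegrable_iff_integrableOn_Ioc_of_le zero_le_one).1
        (hH.intervalIntegrable_cost hγ)
  have hivt : ∀ c ∈ Icc 0 (F 1), ∃ τ ∈ Icc (0 : ℝ) 1, F τ = c := by
    have := intermediate_value_Icc zero_le_one hcont
    rw [hF0] at this
    exact this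
  choose! τ hτ hFτ using hivt
  have ha : 0 ≤ F 1 := hH.cost_nonneg hγ le_rfl zero_le_one le_rfl
  have heq : ∀ c ∈ Icc (0 : ℝ) 1, ∀ c' ∈ Icc (0 : ℝ) 1, F c = F c' → γ c = γ c' := by
    intro c hc c' hc' h
    have := hFd c hc c' hc'
    rw [h, sub_self, abs_zero] at this
    exact dist_le_zero.1 (nonpos_of_mul_nonpos_right this hH.pos)
  refine ⟨F 1, fun c => γ (τ c), ha, hlt, fun c hc => ⟨hγ.2 (hτ c hc), ?_⟩, fun c hc c' hc' => ?_,
    ?_, ?_⟩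
  · exact (hH.attachmentTime_le_of_mem hγ h0 (hτ c hc)).trans_eq (hFτ c hc)
  · have := hFd _ (hτ c hc) _ (hτ c' hc')
    rwa [hFτ c hc, hFτ c' hc'] at this
  · have hm : (0 : ℝ) ∈ Icc 0 (F 1) := ⟨le_rfl, ha⟩
    beta_reduce
    rw [heq (τ 0) (hτ 0 hm) 0 (by simp) (by rw [hFτ 0 hm, hF0])]
    exact h0
  · have hm : F 1 ∈ Icc 0 (F 1) := ⟨ha, le_rfl⟩
    beta_reduce
    rw [heq (τ (F 1)) (hτ _ hm) 1 (by simp) (hFτ _ hm), h1]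

/-- Append the segment to a nearly optimal curve for `x`, each piece run at double speed on half of
`[0, 1]`. -/
theorem IsHamiltonian.attachmentTime_le_add (hH : IsHamiltonian Ω H σl σu)
    (hΩ : IsConstrainingSet Ω) (hV : V₀ ⊆ Ω) (hne : V₀.Nonempty)
    (hseg : segment ℝ x y ⊆ closure Ω) :
    attachmentTime H Ω V₀ y ≤ attachmentTime H Ω V₀ x + σu * dist x y := by
  have hx : x ∈ closure Ω := hseg (left_mem_segment ℝ x y)
  refine le_of_forall_pos_lt_add fun δ hδ => ?_
  obtain ⟨γ, hγ, h0, h1, hlt⟩ :=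
    exists_curve_of_attachmentTime_lt hΩ hV hne hx (lt_add_of_pos_right _ hδ)
  set γ' : ℝ → 𝔼 n := fun s =>
    if s ≤ 1 / 2 then γ (2 * s) else x + (2 * s - 1) • (y - x) with hγ'
  have e₁ : EqOn γ' (fun s => γ (2 * s)) (Icc 0 (1 / 2)) := fun s hs => if_pos hs.2
  have e₂ : EqOn γ' (fun s => x + (2 * s - 1) • (y - x)) (Icc (1 / 2) 1) := by
    intro s hs
    rcases hs.1.eq_or_lt with rfl | h
    · simp [hγ', h1]
    · exact if_neg (not_le.2 h)
  have hl : IsLipCurve (closure Ω) γ' := by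
    obtain ⟨K, hK⟩ := hγ.1
    refine ⟨⟨max (K * 2) (2 * ‖y - x‖₊), lipschitzOnWith_Icc_append (b := 1 / 2) ?_ ?_⟩, ?_⟩
    · have : LipschitzOnWith (K * 2) γ' (Icc 0 (1 / 2)) := by
        refine LipschitzOnWith.of_dist_le_mul fun a ha b hb => ?_
        rw [e₁ ha, e₁ hb]
        have := hK.dist_le_mul (2 * a) ⟨by linarith [ha.1], by linarith [ha.2]⟩ (2 * b)
          ⟨by linarith [hb.1], by linarith [hb.2]⟩
        rw [Real.dist_eq, ← mul_sub, abs_mul, abs_two] at this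
        rw [Real.dist_eq]
        push_cast
        linarith
      exact this.weaken (le_max_left _ _)
    · have : LipschitzOnWith (2 * ‖y - x‖₊) γ' (Icc (1 / 2) 1) := by
        refine LipschitzOnWith.of_dist_le_mul fun a ha b hb => ?_
        rw [e₂ ha, e₂ hb]
        simp only [dist_add_left]
        rw [dist_eq_norm, ← sub_smul, norm_smul, Real.dist_eq, Real.norm_eq_abs,
          show 2 * a - 1 - (2 * b - 1) = 2 * (a - b) by ring, abs_mul, abs_two]
        push_cast
        exact le_of_eq (by ring)
      exact this.weaken (le_max_right _ _)
    · intro s hs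
      rcases le_total s (1 / 2) with h | h
      · rw [e₁ ⟨hs.1, h⟩]
        exact hγ.2 ⟨by linarith [hs.1], by linarith⟩
      · rw [e₂ ⟨h, hs.2⟩]
        refine hseg ?_
        rw [segment_eq_image']
        exact ⟨2 * s - 1, ⟨by linarith, by linarith [hs.2]⟩, rfl⟩
  have hle := hH.attachmentTime_le (V₀ := V₀) hl (by rw [e₁ (by simp)]; simpa using h0)
  have hy : γ' 1 = y := by rw [e₂ (by norm_num)]; norm_num
  rw [hy, ← intervalIntegral.integral_add_adjacent_intervals
    (hH.intervalIntegrable_cost_of_le hl le_rfl (by norm_num) (by norm_num : (1 / 2 : ℝ) ≤ 1))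
    (hH.intervalIntegrable_cost_of_le hl (by norm_num) (by norm_num) le_rfl)] at hle
  have i₁ : ∫ s in (0 : ℝ)..1 / 2, supportFun H (γ' s) (deriv γ' s) =
      ∫ s in (0 : ℝ)..1, supportFun H (γ s) (deriv γ s) := by
    rw [show (1 : ℝ) = 2 * (1 / 2) by norm_num, ← integral_cost_comp_mul H γ zero_le_two]
    norm_num only
    refine intervalIntegral.integral_congr_Ioo_of_le (by norm_num) fun s hs => ?_
    have hev : γ' =ᶠ[𝓝 s] fun s => γ (2 * s) :=
      mem_of_superset (Icc_mem_nhds hs.1 hs.2) e₁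
    rw [hev.deriv_eq, hev.eq_of_nhds]
  have i₂ : ∫ s in (1 / 2 : ℝ)..1, supportFun H (γ' s) (deriv γ' s) ≤ σu * dist x y := by
    have : ∫ s in (1 / 2 : ℝ)..1, supportFun H (γ' s) (deriv γ' s) ≤
        ∫ s in (1 / 2 : ℝ)..1, σu * (2 * dist x y) := by
      refine intervalIntegral.integral_mono_on_of_le_Ioo (by norm_num)
        (hH.intervalIntegrable_cost_of_le hl (by norm_num) (by norm_num) le_rfl)
        (by simp) fun s hs => ?_
      have hev : γ' =ᶠ[𝓝 s] fun s => x + (2 * s - 1) • (y - x) :=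
        mem_of_superset (Icc_mem_nhds hs.1 hs.2) e₂
      have hd : HasDerivAt (fun s : ℝ => x + (2 * s - 1) • (y - x)) ((2 : ℝ) • (y - x)) s := by
        have : HasDerivAt (fun s : ℝ => 2 * s - 1) 2 s := by
          simpa using ((hasDerivAt_id s).const_mul 2).sub_const 1
        exact (this.smul_const _).const_add _
      have hmem : γ' s ∈ closure Ω := hl.2 ⟨by linarith [hs.1], hs.2.le⟩
      refine (hH.supportFun_le hmem _).trans_eq ?_
      rw [hev.deriv_eq, hd.deriv, norm_smul, Real.norm_two, dist_comm, dist_eq_norm]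
    refine this.trans_eq ?_
    rw [intervalIntegral.integral_const, smul_eq_mul]
    ring
  rw [i₁] at hle
  linarith

end value

/-! ### Balls and frontiers -/

/-- The ball is connected and misses the frontier, so it cannot leave `U`. -/
theorem ball_infDist_frontier_subset {U : Set (𝔼 n)} {p : 𝔼 n} (hp : p ∈ U) :
    Metric.ball p (Metric.infDist p (frontier U)) ⊆ U := by
  intro w hw
  by_contra hwU
  have hconn : IsPreconnected (Metric.ball p (Metric.infDist p (frontier U))) :=
    (convex_ball _ _).isPreconnected
  have hpos : 0 < Metric.infDist p (frontier U) := dist_nonneg.trans_lt hw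
  obtain ⟨q, hq, hqf⟩ : (Metric.ball p (Metric.infDist p (frontier U)) ∩ frontier U).Nonempty := by
    by_contra hne
    have hd : Disjoint (Metric.ball p (Metric.infDist p (frontier U))) (frontier U) :=
      disjoint_iff_inter_eq_empty.2 (not_nonempty_iff_eq_empty.1 hne)
    have hsub : ∀ y ∈ Metric.ball p (Metric.infDist p (frontier U)),
        y ∈ interior U ∨ y ∈ interior Uᶜ := fun y hy => by
      have := Set.disjoint_left.1 hd hy
      rw [frontier_eq_inter_compl_interior, mem_inter_iff, mem_compl_iff, mem_compl_iff] at this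
      tauto
    obtain ⟨y, -, hy₁, hy₂⟩ := hconn _ _ isOpen_interior isOpen_interior hsub
      ⟨p, Metric.mem_ball_self hpos, (hsub p (Metric.mem_ball_self hpos)).resolve_right
        fun h => interior_subset h hp⟩
      ⟨w, hw, (hsub w hw).resolve_left fun h => hwU (interior_subset h)⟩
    exact interior_subset hy₂ (interior_subset hy₁)
  exact (Metric.mem_ball'.1 hq).not_ge (Metric.infDist_le_dist_of_mem hqf)

theorem le_infDist_frontier {U : Set (𝔼 n)} {p : 𝔼 n} {r : ℝ} (hU : (frontier U).Nonempty)
    (hr : Metric.ball p r ⊆ U) : r ≤ Metric.infDist p (frontier U) := by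
  rw [Metric.le_infDist hU]
  intro q hq
  by_contra! hlt
  exact hq.2 (interior_maximal hr Metric.isOpen_ball (Metric.mem_ball'.2 hlt))

/-- `Metric.infDist` to the empty set is `0`, so the John inequality needs separate care when there
is no frontier. For bounded sets this happens only in dimension zero. -/
theorem subsingleton_of_frontier_eq_empty {U : Set (𝔼 n)} (hb : Bornology.IsBounded U)
    (hne : U.Nonempty) (hU : ¬ (frontier U).Nonempty) : Subsingleton (𝔼 n) := by
  rw [not_nonempty_iff_eq_empty, ← isClopen_iff_frontier_eq_empty] at hU
  rw [hU.eq_univ hne] at hb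
  by_contra h
  rw [not_subsingleton_iff_nontrivial] at h
  exact NormedSpace.unbounded_univ ℝ (𝔼 n) hb

/-! ### Curves along which the distance to the complement grows linearly -/

/-- There is a curve of Lipschitz constant one on `[0, l]` from `x` to `y` in `U` such that the
ball around its point at time `s` of radius `κ * s` lies in `U`. -/
def CarrotPath (U : Set (𝔼 n)) (κ l : ℝ) (x y : 𝔼 n) : Prop :=
  ∃ γ : ℝ → 𝔼 n, LipschitzOnWith 1 γ (Icc 0 l) ∧ γ 0 = x ∧ γ l = y ∧
    ∀ s ∈ Icc 0 l, γ s ∈ U ∧ Metric.ball (γ s) (κ * s) ⊆ U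

theorem IsJohnDomain.exists_carrotPath {U : Set (𝔼 n)} {x₀ x : 𝔼 n} {κ : ℝ}
    (h : IsJohnDomain U x₀ κ) (hx : x ∈ U) :
    ∃ l, 0 ≤ l ∧ κ * l ≤ Metric.infDist x₀ (frontier U) ∧ CarrotPath U κ l x x₀ := by
  obtain ⟨-, -, -, -, h⟩ := h
  obtain ⟨l, hl, γ, hs, hm, h0, h1, hκ⟩ := h x hx
  refine ⟨l, hl, h1 ▸ hκ l ⟨hl, le_rfl⟩, γ, fun a ha b hb => ?_, h0, h1, fun s hs => ⟨hm hs, ?_⟩⟩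
  · have key : ∀ a ∈ Icc 0 l, ∀ b ∈ Icc 0 l, a ≤ b → edist (γ a) (γ b) ≤ edist a b := by
      intro a ha b hb hab
      refine (eVariationOn.edist_le γ (s := Icc 0 l ∩ Icc a b) ⟨ha, le_rfl, hab⟩
        ⟨hb, hab, le_rfl⟩).trans ?_
      rw [hs ha hb, edist_comm, edist_dist, Real.dist_eq, NNReal.coe_one, one_mul,
        abs_of_nonneg (sub_nonneg.2 hab)]
    rw [ENNReal.coe_one, one_mul]
    rcases le_total a b with hab | hab
    · exact key a ha b hb hab
    · rw [edist_comm, edist_comm a]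
      exact key b hb a ha hab
  · exact (Metric.ball_subset_ball (hκ s hs)).trans (ball_infDist_frontier_subset (hm hs))

/-- Reparametrize by arc length. The curve is 1-Lipschitz, so the arc length `u` reached at time `s`
is at most `s`, and a bound from below by `κ * s` implies the one by `κ * u`. -/
theorem exists_unitSpeed_of_lipschitz {γ : ℝ → 𝔼 n} {τ : ℝ} (hτ : 0 ≤ τ)
    (hγ : LipschitzOnWith 1 γ (Icc 0 τ)) :
    ∃ (l : ℝ) (γ' : ℝ → 𝔼 n), 0 ≤ l ∧ HasUnitSpeedOn γ' (Icc 0 l) ∧ γ' 0 = γ 0 ∧ γ' l = γ τ ∧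
      ∀ u ∈ Icc 0 l, ∃ s ∈ Icc 0 τ, u ≤ s ∧ γ' u = γ s := by
  have hv := hγ.locallyBoundedVariationOn
  have h0 : (0 : ℝ) ∈ Icc 0 τ := ⟨le_rfl, hτ⟩
  have h1 : τ ∈ Icc 0 τ := ⟨hτ, le_rfl⟩
  set a := variationOnFromTo γ (Icc 0 τ) 0 with ha
  have hmono : MonotoneOn a (Icc 0 τ) := variationOnFromTo.monotoneOn hv h0
  have ha0 : a 0 = 0 := variationOnFromTo.self _ _ _
  have hinc : ∀ s ∈ Icc 0 τ, ∀ s' ∈ Icc 0 τ, s ≤ s' → a s' - a s ≤ s' - s := by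
    intro s hs s' hs' hss
    rw [ha, ← variationOnFromTo.add hv h0 hs hs', add_sub_cancel_left,
      variationOnFromTo.eq_of_le _ _ hss]
    refine ENNReal.toReal_le_of_le_ofReal (sub_nonneg.2 hss) ?_
    have := hγ.comp_eVariationOn_le (g := id) (s := Icc 0 τ ∩ Icc s s') fun u hu => hu.1
    refine this.trans ?_
    rw [ENNReal.coe_one, one_mul, (monotone_id.monotoneOn _).eVariationOn_eq hs hs', id, id]
  have hlip : LipschitzOnWith 1 a (Icc 0 τ) := by
    refine LipschitzOnWith.of_dist_le_mul fun s hs s' hs' => ?_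
    rw [NNReal.coe_one, one_mul, Real.dist_eq, Real.dist_eq]
    rcases le_total s s' with h | h
    · rw [abs_sub_comm, abs_of_nonneg (sub_nonneg.2 (hmono hs hs' h)), abs_sub_comm,
        abs_of_nonneg (sub_nonneg.2 h)]
      exact hinc s hs s' hs' h
    · rw [abs_of_nonneg (sub_nonneg.2 (hmono hs' hs h)), abs_of_nonneg (sub_nonneg.2 h)]
      exact hinc s' hs' s hs h
  have himg : a '' Icc 0 τ = Icc 0 (a τ) := by
    refine Subset.antisymm ?_ ?_
    · rintro _ ⟨s, hs, rfl⟩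
      exact ⟨ha0 ▸ hmono h0 hs hs.1, hmono hs h1 hs.2⟩
    · have := intermediate_value_Icc hτ hlip.continuousOn
      rwa [ha0] at this
  have hnat : ∀ s ∈ Icc 0 τ, naturalParameterization γ (Icc 0 τ) 0 (a s) = γ s := fun s hs =>
    edist_eq_zero.1 (edist_naturalParameterization_eq_zero hv h0 hs)
  refine ⟨a τ, naturalParameterization γ (Icc 0 τ) 0, ha0 ▸ hmono h0 h1 hτ,
    himg ▸ has_unit_speed_naturalParameterization γ hv h0, ?_, hnat τ h1, fun u hu => ?_⟩
  · have := hnat 0 h0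
    rwa [ha0] at this
  · rw [← himg] at hu
    obtain ⟨s, hs, rfl⟩ := hu
    refine ⟨s, hs, ?_, hnat s hs⟩
    have := hinc 0 h0 s hs hs.1
    rwa [ha0, sub_zero, sub_zero] at this

theorem isJohnDomain_of_carrotPath {U : Set (𝔼 n)} {x₀ : 𝔼 n} {κ : ℝ}
    (hb : Bornology.IsBounded U) (hx₀ : x₀ ∈ U) (hκ : 0 < κ) (hκ' : κ ≤ 1)
    (h : ∀ x ∈ U, ∃ l, 0 ≤ l ∧ CarrotPath U κ l x x₀) : IsJohnDomain U x₀ κ := by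
  refine ⟨hb, hx₀, hκ, hκ', fun x hx => ?_⟩
  by_cases hf : (frontier U).Nonempty
  · obtain ⟨τ, hτ, γ, hγ, h0, h1, hU⟩ := h x hx
    obtain ⟨l, γ', hl, hs, h0', h1', hγ'⟩ := exists_unitSpeed_of_lipschitz hτ hγ
    refine ⟨l, hl, γ', hs, fun u hu => ?_, h0'.trans h0, h1'.trans h1, fun u hu => ?_⟩
    · obtain ⟨s, hs, -, he⟩ := hγ' u hu
      rw [he]
      exact (hU s hs).1
    · obtain ⟨s, hs, hus, he⟩ := hγ' u hu
      rw [he]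
      exact (mul_le_mul_of_nonneg_left hus hκ.le).trans (le_infDist_frontier hf (hU s hs).2)
  · have := subsingleton_of_frontier_eq_empty hb ⟨x₀, hx₀⟩ hf
    refine ⟨0, le_rfl, fun _ => x, ?_, fun _ _ => hx, rfl, Subsingleton.elim _ _, fun s hs => ?_⟩
    · exact hasConstantSpeedOnWith_of_subsingleton _ (by simp) _
    · rw [Icc_self, mem_singleton_iff] at hs
      rw [hs, mul_zero]
      exact Metric.infDist_nonneg

theorem CarrotPath.append {U : Set (𝔼 n)} {κ l l' : ℝ} {x y : 𝔼 n} (h : CarrotPath U κ l x y)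
    (hl : 0 ≤ l) (hll : l ≤ l') {g : ℝ → 𝔼 n} (hg : LipschitzOnWith 1 g (Icc l l')) (hgl : g l = y)
    (hU : ∀ s ∈ Icc l l', g s ∈ U ∧ Metric.ball (g s) (κ * s) ⊆ U) :
    CarrotPath U κ l' x (g l') := by
  obtain ⟨γ, hγ, h0, h1, hκ⟩ := h
  set γ' : ℝ → 𝔼 n := fun s => if s ≤ l then γ s else g s with hγ'
  have e₁ : EqOn γ' γ (Icc 0 l) := fun s hs => if_pos hs.2
  have e₂ : EqOn γ' g (Icc l l') := by
    intro s hs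
    rcases hs.1.eq_or_lt with rfl | h
    · simp [hγ', h1, hgl]
    · exact if_neg (not_le.2 h)
  refine ⟨γ', lipschitzOnWith_Icc_append (b := l) ?_ ?_, ?_, e₂ ⟨hll, le_rfl⟩, fun s hs => ?_⟩
  · intro a ha b hb
    rw [e₁ ha, e₁ hb]
    exact hγ ha hb
  · intro a ha b hb
    rw [e₂ ha, e₂ hb]
    exact hg ha hb
  · rw [e₁ ⟨le_rfl, hl⟩, h0]
  · rcases le_total s l with h | h
    · rw [e₁ ⟨hs.1, h⟩]
      exact hκ s ⟨hs.1, h⟩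
    · rw [e₂ ⟨h, hs.2⟩]
      exact hU s ⟨h, hs.2⟩

/-- The time `l' - l` may exceed the length of the segment. With `z = y` the lemma lets the curve
wait. -/
theorem CarrotPath.append_segment {U : Set (𝔼 n)} {κ l l' : ℝ} {x y z : 𝔼 n}
    (h : CarrotPath U κ l x y) (hκ : 0 < κ) (hl : 0 ≤ l) (hl' : 0 < l') (hd : dist y z ≤ l' - l)
    (hU : ∀ w ∈ segment ℝ y z, Metric.ball w (κ * l') ⊆ U) : CarrotPath U κ l' x z := by
  have hll : l ≤ l' := sub_nonneg.1 (dist_nonneg.trans hd)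
  rcases hll.eq_or_lt with rfl | hlt
  · rw [sub_self] at hd
    rwa [← dist_le_zero.1 hd]
  have hpos : 0 < l' - l := sub_pos.2 hlt
  have := h.append hl hll (g := AffineMap.lineMap y z ∘ fun s => (s - l) / (l' - l)) ?_ ?_ ?_
  · simpa [div_self hpos.ne'] using this
  · refine LipschitzOnWith.of_dist_le_mul fun a _ b _ => ?_
    simp only [Function.comp, dist_lineMap_lineMap, NNReal.coe_one, one_mul, Real.dist_eq]
    rw [← sub_div, sub_sub_sub_cancel_right, abs_div, abs_of_pos hpos, div_mul_eq_mul_div,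
      div_le_iff₀ hpos]
    exact mul_le_mul_of_nonneg_left hd (abs_nonneg _)
  · simp
  · intro s hs
    have hmem : AffineMap.lineMap y z ((s - l) / (l' - l)) ∈ segment ℝ y z := by
      rw [segment_eq_image_lineMap]
      exact ⟨_, ⟨div_nonneg (sub_nonneg.2 hs.1) hpos.le,
        (div_le_one hpos).2 (by linarith [hs.2])⟩, rfl⟩
    have hb := hU _ hmem
    exact ⟨hb (Metric.mem_ball_self (mul_pos hκ hl')),
      (Metric.ball_subset_ball (mul_le_mul_of_nonneg_left hs.2 hκ.le)).trans hb⟩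

/-! ### Consequences of the touching balls -/

theorem exists_frontier_infDist_compl {Ω : Set (𝔼 n)} (hΩ : IsOpen Ω) (hne : Ω ≠ univ) {p : 𝔼 n}
    (hp : p ∈ closure Ω) : ∃ q ∈ frontier Ω, Metric.infDist p Ωᶜ = dist p q := by
  obtain ⟨q, hq, he⟩ := hΩ.isClosed_compl.exists_infDist_eq_dist (nonempty_compl.2 hne) p
  refine ⟨q, ?_, he⟩
  rw [hΩ.frontier_eq]
  refine ⟨?_, hq⟩
  rcases eq_or_ne (dist p q) 0 with h0 | h0
  · rwa [← dist_eq_zero.1 h0]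
  · refine closure_mono (Metric.ball_infDist_compl_subset (x := p)) ?_
    rw [he, closure_ball _ h0]
    exact Metric.mem_closedBall'.2 le_rfl

theorem add_le_dist_of_ball_subset {Ω : Set (𝔼 n)} {p q : 𝔼 n} {r ε : ℝ} (hr : 0 < r) (hε : 0 < ε)
    (hp : Metric.ball p r ⊆ Ω) (hq : Metric.ball q ε ⊆ (closure Ω)ᶜ) : r + ε ≤ dist p q := by
  rw [← disjoint_ball_ball_iff hr hε, Set.disjoint_left]
  exact fun w hw hw' => hq hw' (subset_closure (hp hw))

/-- This is the equality case of the triangle inequality. It aligns the centers of balls that touch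
an exterior ball at the same point. -/
theorem eq_neg_smul_of_add_le_norm_sub {F : Type*} [NormedAddCommGroup F] [InnerProductSpace ℝ F]
    {a b : F} {c d : ℝ} (hc : 0 < c) (hd : 0 ≤ d) (ha : ‖a‖ = d) (hb : ‖b‖ = c)
    (h : d + c ≤ ‖a - b‖) : a = -((d / c) • b) := by
  have h2 : (d + c) ^ 2 ≤ ‖a - b‖ ^ 2 := pow_le_pow_left₀ (by positivity) h 2
  rw [norm_sub_sq_real, ha, hb] at h2
  have h3 : ‖a + (d / c) • b‖ ^ 2 ≤ 0 := by
    rw [norm_add_sq_real, inner_smul_right, norm_smul, Real.norm_of_nonneg (by positivity), ha, hb,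
      div_mul_cancel₀ _ hc.ne']
    have : d / c * inner ℝ a b ≤ d / c * (-(d * c)) :=
      mul_le_mul_of_nonneg_left (by linarith) (by positivity)
    have e : d / c * (-(d * c)) = -d ^ 2 := by field_simp
    linarith
  have h4 : ‖a + (d / c) • b‖ = 0 := by
    have := sq_nonneg ‖a + (d / c) • b‖
    exact pow_eq_zero_iff two_ne_zero |>.1 (le_antisymm h3 this)
  exact eq_neg_of_add_eq_zero_left (norm_eq_zero.1 h4)

/-- Let `q` be the frontier point nearest to `x`. The ball around `x` of radius `d` and the interior
ball both touch the exterior ball at `q`, so `x` and `xi` lie on one normal ray from `q`. Moving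
along it until depth `ε` gives depth `min (d + s) ε ≥ s` at time `s`. -/
theorem HasTouchingBalls.exists_inward_path {Ω : Set (𝔼 n)} {ε : ℝ} (h : HasTouchingBalls Ω ε)
    (hΩ : IsOpen Ω) (hε : 0 < ε) {x : 𝔼 n} (hx : x ∈ closure Ω) :
    ∃ z : ℝ → 𝔼 n, LipschitzWith 1 z ∧ z 0 = x ∧ ∀ s ≤ ε, Metric.ball (z s) s ⊆ Ω := by
  rcases eq_or_ne Ω univ with rfl | hne
  · exact ⟨fun _ => x, LipschitzWith.const' x |>.weaken zero_le_one, rfl, fun _ _ => subset_univ _⟩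
  set d := Metric.infDist x Ωᶜ with hd
  have hd0 : 0 ≤ d := Metric.infDist_nonneg
  have hxd : Metric.ball x d ⊆ Ω := Metric.ball_infDist_compl_subset
  rcases le_or_gt ε d with hεd | hdε
  · exact ⟨fun _ => x, LipschitzWith.const' x |>.weaken zero_le_one, rfl,
      fun s hs => (Metric.ball_subset_ball (hs.trans hεd)).trans hxd⟩
  obtain ⟨q, hq, hdq⟩ := exists_frontier_infDist_compl hΩ hne hx
  obtain ⟨xi, xe, hi, he, hqi, hqe⟩ := h q hq
  have e₁ : xi - q = -(xe - q) := by
    have := eq_neg_smul_of_add_le_norm_sub hε hε.le (a := xi - q) (b := xe - q)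
      (by rw [← dist_eq_norm, dist_comm, hqi]) (by rw [← dist_eq_norm, dist_comm, hqe])
      (by rw [sub_sub_sub_cancel_right, ← dist_eq_norm]
          exact add_le_dist_of_ball_subset hε hε hi he)
    rwa [div_self hε.ne', one_smul] at this
  have e₂ : x - q = (d / ε) • (xi - q) := by
    rcases hd0.eq_or_lt with h0 | h0
    · rw [← hd, ← h0] at hdq
      rw [← h0, dist_eq_zero.1 hdq.symm, zero_div, zero_smul, sub_self]
    · have := eq_neg_smul_of_add_le_norm_sub hε hd0 (a := x - q) (b := xe - q)
        (by rw [← dist_eq_norm]; exact hdq.symm) (by rw [← dist_eq_norm, dist_comm, hqe])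
        (by rw [sub_sub_sub_cancel_right, ← dist_eq_norm]
            exact add_le_dist_of_ball_subset h0 hε hxd he)
      rw [this, e₁, smul_neg]
  have hu : ‖xi - q‖ = ε := by rw [← dist_eq_norm, dist_comm, hqi]
  refine ⟨fun s => q + (min (d + s) ε / ε) • (xi - q), ?_, ?_, fun s hs => ?_⟩
  · refine LipschitzWith.of_dist_le_mul fun a b => ?_
    rw [dist_add_left, dist_eq_norm, ← sub_smul, norm_smul, hu, ← sub_div, norm_div,
      Real.norm_of_nonneg hε.le, div_mul_cancel₀ _ hε.ne', NNReal.coe_one, one_mul, Real.dist_eq,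
      Real.norm_eq_abs]
    refine (abs_min_sub_min_le_max _ _ _ _).trans ?_
    rw [sub_self, abs_zero, add_sub_add_left_eq_sub]
    exact (max_eq_left (abs_nonneg _)).le
  · simp only [add_zero]
    rw [min_eq_left hdε.le, ← e₂, add_sub_cancel]
  · refine Subset.trans ?_ hi
    refine Metric.ball_subset_ball' ?_
    rw [dist_eq_norm, show q + (min (d + s) ε / ε) • (xi - q) - xi =
      (min (d + s) ε / ε - 1) • (xi - q) by module, norm_smul, hu, Real.norm_eq_abs,
      abs_of_nonpos (sub_nonpos.2 ((div_le_one hε).2 (min_le_right _ _))), neg_sub, sub_mul,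
      div_mul_cancel₀ _ hε.ne']
    have : s ≤ min (d + s) ε := le_min (by linarith) hs
    linarith

theorem norm_lineMap_sq {F : Type*} [NormedAddCommGroup F] [InnerProductSpace ℝ F] (z w : F)
    {a b : ℝ} (hab : a + b = 1) :
    ‖a • z + b • w‖ ^ 2 = a * ‖z‖ ^ 2 + b * ‖w‖ ^ 2 - a * b * ‖z - w‖ ^ 2 := by
  rw [norm_add_sq_real, norm_sub_sq_real, norm_smul, norm_smul, inner_smul_left, inner_smul_right,
    mul_pow, mul_pow, Real.norm_eq_abs, Real.norm_eq_abs, sq_abs, sq_abs]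
  obtain rfl : b = 1 - a := by linarith
  simp only [conj_trivial]
  ring

/-- Both endpoints have distance at least `r + ε` from the center of any exterior ball. By
`norm_lineMap_sq` the squared distance drops by at most `ε * r` along the segment, and `(r + ε) ^ 2
- ε * r > (r / 2 + ε) ^ 2`. -/
theorem HasTouchingBalls.ball_subset_of_mem_segment {Ω : Set (𝔼 n)} {ε : ℝ}
    (h : HasTouchingBalls Ω ε) (hΩ : IsOpen Ω) (hε : 0 < ε) {z w p : 𝔼 n} {r : ℝ} (hr : 0 < r)
    (hz : Metric.ball z r ⊆ Ω) (hw : Metric.ball w r ⊆ Ω) (hd : dist z w ^ 2 ≤ 4 * ε * r)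
    (hp : p ∈ segment ℝ z w) : Metric.ball p (r / 2) ⊆ Ω := by
  rcases eq_or_ne Ω univ with rfl | hne
  · exact subset_univ _
  have hnear : ∀ p ∈ segment ℝ z w, p ∈ Ω → r / 2 ≤ Metric.infDist p Ωᶜ := by
    intro p hp hpΩ
    obtain ⟨q, hq, hdq⟩ := exists_frontier_infDist_compl hΩ hne (subset_closure hpΩ)
    obtain ⟨-, xe, -, he, -, hqe⟩ := h q hq
    have h₁ := add_le_dist_of_ball_subset hr hε hz he
    have h₂ := add_le_dist_of_ball_subset hr hε hw he
    obtain ⟨a, b, ha, hb, hab, rfl⟩ := hp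
    have h₃ : dist (a • z + b • w) xe ≤ Metric.infDist (a • z + b • w) Ωᶜ + ε := by
      rw [hdq, ← hqe]
      exact dist_triangle _ _ _
    have h₄ := norm_lineMap_sq (z - xe) (w - xe) hab
    rw [show a • (z - xe) + b • (w - xe) = a • z + b • w - xe by
      obtain rfl : b = 1 - a := by linarith
      module, sub_sub_sub_cancel_right, ← dist_eq_norm, ← dist_eq_norm, ← dist_eq_norm,
      ← dist_eq_norm] at h₄
    have h₅ : (r + ε) ^ 2 ≤ dist z xe ^ 2 := pow_le_pow_left₀ (by positivity) h₁ 2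
    have h₆ : (r + ε) ^ 2 ≤ dist w xe ^ 2 := pow_le_pow_left₀ (by positivity) h₂ 2
    have h₇ : a * b ≤ 1 / 4 := by
      obtain rfl : b = 1 - a := by linarith
      nlinarith [sq_nonneg (a - 1 / 2)]
    have h₈ : a * b * dist z w ^ 2 ≤ ε * r := by
      have := mul_le_mul h₇ hd (sq_nonneg _) (by norm_num)
      linarith
    have h₉ : (r + ε) ^ 2 ≤ a * dist z xe ^ 2 + b * dist w xe ^ 2 := by
      have := mul_le_mul_of_nonneg_left h₅ ha
      have := mul_le_mul_of_nonneg_left h₆ hb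
      have : (r + ε) ^ 2 = a * (r + ε) ^ 2 + b * (r + ε) ^ 2 := by rw [← add_mul, hab, one_mul]
      linarith
    by_contra! hlt
    have : dist (a • z + b • w) xe ^ 2 < (r / 2 + ε) ^ 2 :=
      pow_lt_pow_left₀ (by linarith) dist_nonneg two_ne_zero
    nlinarith [mul_pos hr hε, mul_pos hr hr]
  suffices hall : r / 2 ≤ Metric.infDist p Ωᶜ from
    (Metric.ball_subset_ball hall).trans Metric.ball_infDist_compl_subset
  by_contra! hlt
  have hzr : r ≤ Metric.infDist z Ωᶜ := by
    rw [Metric.le_infDist (nonempty_compl.2 hne)]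
    intro y hy
    by_contra! hyz
    exact hy (hz (Metric.mem_ball'.2 hyz))
  -- `hnear` needs the point to lie in `Ω`. If the segment came too close to the complement, by
  -- continuity its distance would take a value strictly between `0` and `r / 2`, at a point of `Ω`,
  -- against `hnear`.
  obtain ⟨p', hp', he⟩ : (max (Metric.infDist p Ωᶜ) (r / 4)) ∈
      (fun p => Metric.infDist p Ωᶜ) '' segment ℝ z w := by
    refine (convex_segment z w).isPreconnected.intermediate_value hp (left_mem_segment ℝ z w)
      (Metric.continuous_infDist_pt _).continuousOn ⟨le_max_left _ _, ?_⟩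
    exact (max_le (by linarith) (by linarith)).trans hzr
  simp only at he
  have hpos : 0 < Metric.infDist p' Ωᶜ := by
    rw [he]
    exact lt_max_of_lt_right (by positivity)
  have := hnear p' hp' (Metric.ball_infDist_compl_subset (Metric.mem_ball_self hpos))
  rw [he] at this
  rcases le_max_iff.1 this with h | h <;> linarith

/-! ### Travel times -/

/-- The properties of the value function from which the regularity of its sublevels is derived. -/
structure IsTravelTime (Ω V₀ : Set (𝔼 n)) (v : 𝔼 n → ℝ) (σl σu : ℝ) : Prop where
  pos : 0 < σl
  le : σl ≤ σu
  isOpen : IsOpen Ω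
  subset : V₀ ⊆ Ω
  eq_zero : ∀ x ∈ closure V₀, v x = 0
  le_add : ∀ x y, segment ℝ x y ⊆ closure Ω → v y ≤ v x + σu * dist x y
  exists_backtrack : ∀ x ∈ closure Ω, ∀ t, v x < t → ∃ (a : ℝ) (β : ℝ → 𝔼 n), 0 ≤ a ∧ a < t ∧
      (∀ c ∈ Icc 0 a, β c ∈ closure Ω ∧ v (β c) ≤ c) ∧
      (∀ c ∈ Icc 0 a, ∀ c' ∈ Icc 0 a, σl * dist (β c) (β c') ≤ |c - c'|) ∧
      β 0 ∈ closure V₀ ∧ β a = x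

/-- The sublevel of `v` in the closure of `Ω`. -/
def sublevelIn (Ω : Set (𝔼 n)) (v : 𝔼 n → ℝ) (t : ℝ) : Set (𝔼 n) := {x | x ∈ closure Ω ∧ v x < t}

namespace IsTravelTime

variable {Ω V₀ : Set (𝔼 n)} {v : 𝔼 n → ℝ} {σl σu ε κ₀ : ℝ} {x₀ : 𝔼 n}

theorem upper_pos (hv : IsTravelTime Ω V₀ v σl σu) : 0 < σu := hv.pos.trans_le hv.le

theorem subset_sublevelIn (hv : IsTravelTime Ω V₀ v σl σu) {t : ℝ} (ht : 0 < t) :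
    V₀ ⊆ sublevelIn Ω v t := fun y hy =>
  ⟨subset_closure (hv.subset hy), by rwa [hv.eq_zero y (subset_closure hy)]⟩

theorem le_add_of_mem_ball (hv : IsTravelTime Ω V₀ v σl σu) {p x y : 𝔼 n} {r : ℝ}
    (hp : Metric.ball p r ⊆ Ω) (hr : 0 < r) (hx : x ∈ Metric.closedBall p r)
    (hy : y ∈ Metric.closedBall p r) : v y ≤ v x + σu * dist x y := by
  refine hv.le_add x y (((convex_closedBall p r).segment_subset hx hy).trans ?_)
  rw [← closure_ball p hr.ne']
  exact closure_mono hp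

theorem ball_subset_sublevelIn (hv : IsTravelTime Ω V₀ v σl σu) {p x : 𝔼 n} {r t : ℝ}
    (hp : Metric.ball p r ⊆ Ω) (hx : dist x p ≤ r) (h : v x + 2 * σu * r ≤ t) :
    Metric.ball p r ⊆ sublevelIn Ω v t := by
  intro w hw
  have hr : 0 < r := dist_nonneg.trans_lt hw
  refine ⟨subset_closure (hp hw), ?_⟩
  have h₁ := hv.le_add_of_mem_ball hp hr (Metric.mem_closedBall.2 hx)
    (Metric.ball_subset_closedBall hw)
  have h₂ : dist x w < 2 * r := by
    have := dist_triangle x p w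
    have := Metric.mem_ball'.1 hw
    linarith
  nlinarith [mul_lt_mul_of_pos_left h₂ hv.upper_pos]

/-- Two balls in `Ω` whose centers are close are joined by a segment that stays away from the
complement of the sublevel. -/
theorem ball_subset_sublevelIn_of_mem_segment (hv : IsTravelTime Ω V₀ v σl σu) (hε : 0 < ε)
    (hΩ : HasTouchingBalls Ω ε) {x p q z : 𝔼 n} {r ρ D t : ℝ} (hr : 0 < r) (hrρ : r ≤ ρ)
    (hp : Metric.ball p ρ ⊆ Ω) (hq : Metric.ball q r ⊆ Ω) (hx : dist x p ≤ ρ)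
    (hD : dist p q ≤ D) (hDε : D ^ 2 ≤ 4 * ε * r) (ht : v x + σu * (ρ + D + r) ≤ t)
    (hz : z ∈ segment ℝ p q) : Metric.ball z (r / 2) ⊆ sublevelIn Ω v t := by
  have hseg : ∀ z ∈ segment ℝ p q, Metric.ball z (r / 2) ⊆ Ω := fun z hz =>
    hΩ.ball_subset_of_mem_segment hv.isOpen hε hr ((Metric.ball_subset_ball hrρ).trans hp) hq
      ((pow_le_pow_left₀ dist_nonneg hD 2).trans hDε) hz
  intro w hw
  refine ⟨subset_closure (hseg z hz hw), ?_⟩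
  have hρ : 0 < ρ := hr.trans_le hrρ
  have h₁ := hv.le_add_of_mem_ball hp hρ (Metric.mem_closedBall.2 hx)
    (Metric.mem_closedBall_self hρ.le)
  have hzD : dist p z ≤ D := by
    obtain ⟨a, ha, rfl⟩ := (segment_eq_image_lineMap ℝ p q) ▸ hz
    rw [dist_left_lineMap, Real.norm_of_nonneg ha.1]
    exact (mul_le_of_le_one_left dist_nonneg ha.2).trans hD
  have h₂ : v z ≤ v p + σu * dist p z := by
    refine hv.le_add p z fun u hu => subset_closure ?_
    have hu' : u ∈ segment ℝ p q :=
      (convex_segment p q).segment_subset (left_mem_segment ℝ p q) hz hu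
    exact hseg u hu' (Metric.mem_ball_self (by positivity))
  have h₃ := hv.le_add_of_mem_ball (hseg z hz) (by positivity)
    (Metric.mem_closedBall_self (by positivity)) (Metric.ball_subset_closedBall hw)
  have h₄ := Metric.mem_ball'.1 hw
  have e₁ := mul_le_mul_of_nonneg_left hx hv.upper_pos.le
  have e₂ := mul_le_mul_of_nonneg_left hzD hv.upper_pos.le
  have e₃ := mul_lt_mul_of_pos_left h₄ hv.upper_pos
  have e₄ := mul_pos hv.upper_pos hr
  nlinarith

theorem _root_.LipschitzWith.dist_apply_zero_le {z : ℝ → 𝔼 n} (hz : LipschitzWith 1 z) {s : ℝ}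
    (hs : 0 ≤ s) : dist (z 0) (z s) ≤ s := by
  refine (hz.dist_le_mul _ _).trans_eq ?_
  rw [NNReal.coe_one, one_mul, Real.dist_eq, zero_sub, abs_neg, abs_of_nonneg hs]

/-- Go inwards for time `ρ`, then wait until time `l`. -/
theorem exists_carrotPath_start (hv : IsTravelTime Ω V₀ v σl σu) (hε : 0 < ε)
    (hΩ : HasTouchingBalls Ω ε) {t κ l ρ : ℝ} {x : 𝔼 n} (hx : x ∈ sublevelIn Ω v t)
    (hκ : 0 < κ) (hκ1 : κ ≤ 1) (hρ : 0 < ρ) (hρε : ρ ≤ ε) (hρt : v x + 2 * σu * ρ ≤ t)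
    (hρl : ρ ≤ l) (hκl : κ * l ≤ ρ) :
    ∃ p, CarrotPath (sublevelIn Ω v t) κ l x p ∧ dist p x ≤ ρ ∧ Metric.ball p ρ ⊆ Ω := by
  obtain ⟨z, hz, hz0, hzΩ⟩ := hΩ.exists_inward_path hv.isOpen hε hx.1
  have hzt : ∀ s, 0 ≤ s → s ≤ ρ → Metric.ball (z s) s ⊆ sublevelIn Ω v t := by
    intro s hs hsρ
    refine hv.ball_subset_sublevelIn (hzΩ s (hsρ.trans hρε)) (x := x)
      (hz0 ▸ hz.dist_apply_zero_le hs) ?_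
    have := mul_le_mul_of_nonneg_left hsρ (mul_nonneg zero_le_two hv.upper_pos.le)
    linarith
  have h₁ : CarrotPath (sublevelIn Ω v t) κ ρ x (z ρ) := by
    refine ⟨z, hz.lipschitzOnWith, hz0, rfl, fun s hs => ⟨?_, ?_⟩⟩
    · rcases hs.1.eq_or_lt with rfl | h
      · rwa [hz0]
      · exact hzt s hs.1 hs.2 (Metric.mem_ball_self h)
    · exact (Metric.ball_subset_ball (mul_le_of_le_one_left hs.1 hκ1)).trans (hzt s hs.1 hs.2)
  refine ⟨z ρ, h₁.append_segment hκ hρ.le (hρ.trans_le hρl) (by rw [dist_self]; linarith) ?_,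
    by rw [dist_comm]; exact hz0 ▸ hz.dist_apply_zero_le hρ.le, hzΩ ρ hρε⟩
  intro w hw
  rw [segment_same, mem_singleton_iff] at hw
  rw [hw]
  exact (Metric.ball_subset_ball hκl).trans (hzt ρ hρ.le le_rfl)

/-- One edge of the polygon, from a point pushed off `b` to one pushed off `b'`. Its length is at
most `ρ + ρ + 2 * ρ`, and `4 * ρ ≤ ε` is what the segment lemma asks for this length. The room `6 *
σu * ρ` pays for `ρ` from `b` to `p`, for the edge, and for a ball of radius below `ρ`. -/
theorem exists_carrotPath_step (hv : IsTravelTime Ω V₀ v σl σu) (hε : 0 < ε)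
    (hΩ : HasTouchingBalls Ω ε) {t κ l ρ ρ' : ℝ} {x b b' p : 𝔼 n} (hb' : b' ∈ closure Ω)
    (hκ : 0 < κ) (hl : 0 ≤ l) (hρ : 0 < ρ) (hρε : 4 * ρ ≤ ε) (hbt : v b + 6 * σu * ρ ≤ t)
    (hbb : dist b b' ≤ ρ) (hρρ : ρ ≤ ρ') (hρ2 : ρ' ≤ 2 * ρ) (hκl : κ * (l + 4 * ρ) ≤ ρ / 2)
    (h : CarrotPath (sublevelIn Ω v t) κ l x p) (hpb : dist p b ≤ ρ) (hp : Metric.ball p ρ ⊆ Ω) :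
    ∃ p', CarrotPath (sublevelIn Ω v t) κ (l + 4 * ρ) x p' ∧ dist p' b' ≤ ρ' ∧
      Metric.ball p' ρ' ⊆ Ω := by
  obtain ⟨z, hz, hz0, hzΩ⟩ := hΩ.exists_inward_path hv.isOpen hε hb'
  have hρ'ε : ρ' ≤ ε := by linarith
  have hzb : dist b' (z ρ') ≤ ρ' := hz0 ▸ hz.dist_apply_zero_le (hρ.le.trans hρρ)
  have hd : dist p (z ρ') ≤ 4 * ρ := by
    have := dist_triangle4 p b b' (z ρ')
    linarith
  refine ⟨z ρ', h.append_segment hκ hl (by linarith) (by linarith) ?_, by rwa [dist_comm],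
    hzΩ _ hρ'ε⟩
  intro w hw
  refine Subset.trans (Metric.ball_subset_ball hκl) (hv.ball_subset_sublevelIn_of_mem_segment hε hΩ
    (x := b) hρ le_rfl hp ((Metric.ball_subset_ball hρρ).trans (hzΩ _ hρ'ε))
    (by rwa [dist_comm]) hd ?_ (by linarith) hw)
  have := mul_le_mul_of_nonneg_right hρε hρ.le
  linarith

/-- A curve in the closure of `Ω` along which the travel time decreases can be pushed into `Ω`. -/
theorem exists_carrotPath_along (hv : IsTravelTime Ω V₀ v σl σu) (hε : 0 < ε)
    (hΩ : HasTouchingBalls Ω ε) {t κ s₀ S : ℝ} {x : 𝔼 n} {B : ℝ → 𝔼 n} {r : ℝ → ℝ}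
    (hκ : 0 < κ) (hs₀ : 0 < s₀) (hs₀S : s₀ ≤ S) (hr : ∀ s, 0 < s → 0 < r s) (hmono : Monotone r)
    (hrs : ∀ s, 0 < s → r s ≤ s) (hrε : ∀ s, 4 * r s ≤ ε)
    (hr2 : ∀ s s', 0 < s → s ≤ s' → s' ≤ s + r s → r s' ≤ 2 * r s)
    (hB : ∀ s ∈ Icc s₀ S, B s ∈ closure Ω) (hBt : ∀ s ∈ Icc s₀ S, v (B s) + 6 * σu * r s ≤ t)
    (hBd : ∀ s ∈ Icc s₀ S, ∀ s' ∈ Icc s₀ S, s ≤ s' → dist (B s) (B s') ≤ s' - s)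
    (hκr : ∀ s ∈ Icc s₀ S, 16 * κ * s ≤ r s) (k : ℕ) :
    ∀ s ∈ Icc s₀ S, S - s ≤ k * r s₀ → ∀ p, CarrotPath (sublevelIn Ω v t) κ (4 * s) x p →
      dist p (B s) ≤ r s → Metric.ball p (r s) ⊆ Ω → ∃ l ≤ 8 * S, 0 ≤ l ∧ ∃ p',
        CarrotPath (sublevelIn Ω v t) κ l x p' ∧ dist p' (B S) ≤ r S ∧
          Metric.ball p' (r S) ⊆ Ω := by
  have step : ∀ s ∈ Icc s₀ S, ∀ s' ∈ Icc s₀ S, s ≤ s' → s' ≤ s + r s → ∀ p,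
      CarrotPath (sublevelIn Ω v t) κ (4 * s) x p → dist p (B s) ≤ r s →
      Metric.ball p (r s) ⊆ Ω → ∃ p', CarrotPath (sublevelIn Ω v t) κ (4 * (s + r s)) x p' ∧
        dist p' (B s') ≤ r s' ∧ Metric.ball p' (r s') ⊆ Ω := by
    intro s hs s' hs' hss hss' p hpath hpB hpΩ
    have hs0 : 0 < s := hs₀.trans_le hs.1
    rw [mul_add]
    refine hv.exists_carrotPath_step hε hΩ (hB s' hs') hκ (by linarith) (hr s hs0) (hrε s)
      (hBt s hs) ((hBd s hs s' hs' hss).trans (by linarith)) (hmono hss) (hr2 s s' hs0 hss hss') ?_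
      hpath hpB hpΩ
    have h₁ := hκr s hs
    have h₂ := mul_le_mul_of_nonneg_left (hrs s hs0) hκ.le
    linarith
  -- `k` bounds the number of remaining edges: each full edge advances `s` by `r s ≥ r s₀`. An edge
  -- advancing by `r s` takes time `4 * r s`, so parameter `s` is reached at time `4 * s`. Only the
  -- last edge is cut short at `S`, at time at most `8 * S` since `r s ≤ s`.
  induction k with
  | zero =>
    intro s hs hk p hpath hpB hpΩ
    obtain rfl : s = S := le_antisymm hs.2 (by simpa using hk)
    exact ⟨4 * s, by linarith, by linarith, p, hpath, hpB, hpΩ⟩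
  | succ k ih =>
    intro s hs hk p hpath hpB hpΩ
    have hs0 : 0 < s := hs₀.trans_le hs.1
    have hrs0 := hr s hs0
    rcases le_total S (s + r s) with hle | hle
    · obtain ⟨p', h₁, h₂, h₃⟩ := step s hs S ⟨hs₀S, le_rfl⟩ hs.2 hle p hpath hpB hpΩ
      have h₄ := hrs s hs0
      exact ⟨_, by linarith [hs.2], by linarith, p', h₁, h₂, h₃⟩
    · have hs' : s + r s ∈ Icc s₀ S := ⟨by linarith [hs.1], hle⟩
      obtain ⟨p', h₁, h₂, h₃⟩ := step s hs _ hs' (by linarith) le_rfl p hpath hpB hpΩ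
      refine ih _ hs' ?_ p' h₁ h₂ h₃
      have := hmono hs.1
      push_cast at hk
      linarith

/-- The first part of the John curve: from a point of the sublevel along a nearly optimal curve,
pushed into `Ω`, to a point near the closure of `V₀`. -/
theorem exists_carrotPath_near_closure (hv : IsTravelTime Ω V₀ v σl σu) (hε : 0 < ε)
    (hΩ : HasTouchingBalls Ω ε) {t κ θ m : ℝ} (hm : 0 < m) (hmε : m ≤ ε)
    (hθ : 0 < θ) (hθσ : 8 * σu * θ ≤ σl) (hκ : 0 < κ) (hκ1 : κ ≤ 1)
    (hκt : ∀ s, 0 < s → s ≤ t / σl → 16 * κ * s ≤ θ * min s m)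
    {x : 𝔼 n} (hx : x ∈ sublevelIn Ω v t) :
    ∃ p, ∃ y ∈ closure V₀, CarrotPath (sublevelIn Ω v t) κ (8 * (t / σl)) x p ∧
      dist p y ≤ θ * min (t / σl) m ∧ Metric.ball p (θ * min (t / σl) m) ⊆ Ω := by
  obtain ⟨a, β, ha, hat, hβ, hβd, hβ0, hβa⟩ := hv.exists_backtrack x hx.1 t hx.2
  have hσ := hv.pos
  have hσu := hv.upper_pos
  have hθ8 : θ ≤ 1 / 8 := by
    have h₁ : σu * (8 * θ) ≤ σu * 1 := by linarith [hv.le]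
    have h₂ := le_of_mul_le_mul_left h₁ hσu
    linarith
  -- The push depth grows linearly, as the John condition demands, and is capped so that the
  -- touching balls apply.
  set r : ℝ → ℝ := fun s => θ * min s m with hr
  set S := t / σl with hS
  -- The parameter starts at `s₀ > 0`, the slack left by `a < t`. Then `B` runs from `x` to `β 0`
  -- and `v (B s) ≤ t - σl * s`, so the room `σl * s ≥ 8 * σu * θ * s` covers each push.
  set s₀ := (t - a) / σl with hs₀
  have hs₀pos : 0 < s₀ := div_pos (sub_pos.2 hat) hσ
  have hs₀S : s₀ ≤ S := div_le_div_of_nonneg_right (by linarith) hσ.le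
  have hSpos : 0 < S := hs₀pos.trans_le hs₀S
  have hmemS : S ∈ Icc s₀ S := ⟨hs₀S, le_rfl⟩
  set B : ℝ → 𝔼 n := fun s => β (t - σl * s) with hB
  have hmem : ∀ s ∈ Icc s₀ S, t - σl * s ∈ Icc 0 a := by
    intro s hs
    have h₁ : s * σl ≤ t := (le_div_iff₀ hσ).1 hs.2
    have h₂ : t - a ≤ s * σl := (div_le_iff₀ hσ).1 hs.1
    exact ⟨by linarith, by linarith⟩
  have hBd : ∀ s ∈ Icc s₀ S, ∀ s' ∈ Icc s₀ S, s ≤ s' → dist (B s) (B s') ≤ s' - s := by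
    intro s hs s' hs' hss
    have := hβd _ (hmem s hs) _ (hmem s' hs')
    rw [show t - σl * s - (t - σl * s') = σl * (s' - s) by ring, abs_mul, abs_of_pos hσ,
      abs_of_nonneg (sub_nonneg.2 hss)] at this
    exact le_of_mul_le_mul_left this hσ
  have hB₀ : B s₀ = x := by
    rw [← hβa, hB, hs₀]
    simp only [mul_div_cancel₀ _ hσ.ne', sub_sub_cancel]
  have hBS : B S = β 0 := by
    rw [hB, hS]
    simp only [mul_div_cancel₀ _ hσ.ne', sub_self]
  have hrpos : ∀ s, 0 < s → 0 < r s := fun s hs => mul_pos hθ (lt_min hs hm)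
  have hrmono : Monotone r := fun s s' h =>
    mul_le_mul_of_nonneg_left (min_le_min_right _ h) hθ.le
  have hrθ : ∀ s, r s ≤ θ * s := fun s => mul_le_mul_of_nonneg_left (min_le_left _ _) hθ.le
  have hrs : ∀ s, 0 < s → r s ≤ s := fun s hs =>
    (hrθ s).trans (mul_le_of_le_one_left hs.le (by linarith))
  have hrε : ∀ s, 4 * r s ≤ ε := by
    intro s
    have h₁ : r s ≤ θ * ε := mul_le_mul_of_nonneg_left ((min_le_right _ _).trans hmε) hθ.le
    have h₂ := mul_le_mul_of_nonneg_right hθ8 hε.le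
    linarith
  have hr2 : ∀ s s', 0 < s → s ≤ s' → s' ≤ s + r s → r s' ≤ 2 * r s := by
    intro s s' hs _ h'
    have : min s' m ≤ min s m + r s := by
      rcases le_total s m with hsm | hsm
      · rw [min_eq_left hsm]
        exact (min_le_left _ _).trans h'
      · rw [min_eq_right hsm]
        exact (min_le_right _ _).trans (by linarith [hrpos s hs])
    have h₂ := mul_le_mul_of_nonneg_left this hθ.le
    rw [mul_add] at h₂
    have h₃ : θ * r s ≤ r s := mul_le_of_le_one_left (hrpos s hs).le (by linarith)
    change r s' ≤ r s + θ * r s at h₂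
    linarith
  have hBt : ∀ s ∈ Icc s₀ S, v (B s) + 6 * σu * r s ≤ t := by
    intro s hs
    have hs0 : 0 < s := hs₀pos.trans_le hs.1
    have h₁ : v (B s) ≤ t - σl * s := (hβ _ (hmem s hs)).2
    have h₂ := mul_le_mul_of_nonneg_left (hrθ s) hσu.le
    have h₃ := mul_le_mul_of_nonneg_right hθσ hs0.le
    have h₄ := mul_pos hσu (hrpos s hs0)
    linarith
  have hκr : ∀ s ∈ Icc s₀ S, 16 * κ * s ≤ r s := fun s hs => hκt s (hs₀pos.trans_le hs.1) hs.2
  have h2 : ∀ y s, 0 < s → v y + 6 * σu * r s ≤ t → v y + 2 * σu * r s ≤ t := by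
    intro y s hs h
    have := mul_pos hσu (hrpos s hs)
    linarith
  have hr₀pos := hrpos s₀ hs₀pos
  obtain ⟨p₀, hpath, hp₀x, hp₀⟩ := hv.exists_carrotPath_start hε hΩ hx hκ hκ1 hr₀pos
    (by linarith [hrε s₀]) (h2 x s₀ hs₀pos (hB₀ ▸ hBt s₀ ⟨le_rfl, hs₀S⟩)) (l := 4 * s₀)
    (by linarith [hrs s₀ hs₀pos])
    (by linarith [hκr s₀ ⟨le_rfl, hs₀S⟩, mul_pos hκ hs₀pos])
  obtain ⟨k, hk⟩ := exists_nat_ge ((S - s₀) / r s₀)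
  obtain ⟨l, hl, hl0, p, h₁, h₂, h₃⟩ := hv.exists_carrotPath_along hε hΩ hκ hs₀pos hs₀S hrpos hrmono
    hrs hrε hr2 (fun s hs => (hβ _ (hmem s hs)).1) hBt hBd hκr k s₀ ⟨le_rfl, hs₀S⟩
    ((div_le_iff₀ hr₀pos).1 hk) p₀ hpath ((congrArg (dist p₀) hB₀).trans_le hp₀x) hp₀
  refine ⟨p, B S, hBS ▸ hβ0, ?_, h₂, h₃⟩
  refine h₁.append_segment hκ hl0 (by linarith) (by rw [dist_self]; linarith) ?_
  intro w hw
  rw [segment_same, mem_singleton_iff] at hw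
  rw [hw]
  refine (Metric.ball_subset_ball ?_).trans
    (hv.ball_subset_sublevelIn h₃ (x := B S) (by rwa [dist_comm]) (h2 _ S hSpos (hBt S hmemS)))
  linarith [hκr S hmemS, mul_pos hκ hSpos]

end IsTravelTime

/-! ### John property, Hausdorff continuity and porosity for the sublevels of a travel time. -/

namespace IsTravelTime

variable {Ω V₀ : Set (𝔼 n)} {v : 𝔼 n → ℝ} {σl σu ε κ₀ : ℝ} {x₀ : 𝔼 n}

/-- The John curve of the sublevel: a pushed nearly optimal curve, followed by a John curve of
`V₀`. -/
theorem exists_carrotPath_center (hv : IsTravelTime Ω V₀ v σl σu) (hε : 0 < ε)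
    (hΩ : HasTouchingBalls Ω ε) (hV : IsJohnDomain V₀ x₀ κ₀) {t κ θ m : ℝ} (ht : 0 < t)
    (hm : 0 < m) (hmε : m ≤ ε) (hmΩ : Metric.ball x₀ m ⊆ Ω) (hθ : 0 < θ)
    (hθσ : 8 * σu * θ ≤ σl) (hθκ : 8 * θ ≤ κ₀) (hκ : 0 < κ)
    (hκt : ∀ s, 0 < s → s ≤ t / σl → 32 * κ * s ≤ κ₀ * (θ * min s m))
    {x : 𝔼 n} (hx : x ∈ sublevelIn Ω v t) :
    ∃ l, 0 ≤ l ∧ CarrotPath (sublevelIn Ω v t) κ l x x₀ := by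
  have hσ := hv.pos
  have hσu := hv.upper_pos
  have hκ₀ : 0 < κ₀ := hV.2.2.1
  have hκ₀1 : κ₀ ≤ 1 := hV.2.2.2.1
  have hS : 0 < t / σl := div_pos ht hσ
  set S := t / σl with hSdef
  set ρ := θ * min S m with hρdef
  have hρ : 0 < ρ := mul_pos hθ (lt_min hS hm)
  have hρS : ρ ≤ θ * S := mul_le_mul_of_nonneg_left (min_le_left _ _) hθ.le
  have hρm : ρ ≤ θ * m := mul_le_mul_of_nonneg_left (min_le_right _ _) hθ.le
  have hρS1 : 8 * ρ ≤ S := by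
    have := mul_le_mul_of_nonneg_right (hθκ.trans hκ₀1) hS.le
    linarith
  have hρm1 : 8 * ρ ≤ κ₀ * m := by
    have := mul_le_mul_of_nonneg_right hθκ hm.le
    linarith
  have hκS : 32 * κ * S ≤ κ₀ * ρ := hκt S hS le_rfl
  have hκ2 : 2 * κ ≤ κ₀ := by
    have h₁ : κ₀ * ρ ≤ κ₀ * S := mul_le_mul_of_nonneg_left (by linarith) hκ₀.le
    have h₂ : (32 * κ) * S ≤ κ₀ * S := hκS.trans h₁
    have h₃ := le_of_mul_le_mul_right h₂ hS
    linarith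
  have hκt' : ∀ s, 0 < s → s ≤ S → 16 * κ * s ≤ θ * min s m := by
    intro s hs hsS
    have h₁ := hκt s hs hsS
    have h₂ : κ₀ * (θ * min s m) ≤ θ * min s m :=
      mul_le_of_le_one_left (mul_pos hθ (lt_min hs hm)).le hκ₀1
    linarith [mul_pos hκ hs]
  obtain ⟨p, y, hy, hpath, hpy, hp⟩ := hv.exists_carrotPath_near_closure hε hΩ hm hmε hθ hθσ hκ
    (by linarith) hκt' hx
  change dist p y ≤ ρ at hpy
  change Metric.ball p ρ ⊆ Ω at hp
  obtain ⟨y₁, hy₁, hyy⟩ := Metric.mem_closure_iff.1 hy ρ hρ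
  obtain ⟨l, hl, -, γ, hγ, hγ0, hγl, hγκ⟩ := hV.exists_carrotPath hy₁
  -- Following the John curve of `V₀` for length `ρ` gives a point with a ball of radius `κ₀ * ρ` in
  -- `Ω`. If the curve is shorter, its end `x₀` serves, with the ball of radius `m`.
  have hmin : min l ρ ∈ Icc 0 l := ⟨le_min hl hρ.le, min_le_left _ _⟩
  have hdq : dist p (γ (min l ρ)) ≤ 3 * ρ := by
    have h₁ := dist_triangle4 p y y₁ (γ (min l ρ))
    have h₂ := hγ.dist_le_mul 0 ⟨le_rfl, hl⟩ _ hmin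
    rw [hγ0, NNReal.coe_one, one_mul, Real.dist_eq, zero_sub, abs_neg, abs_of_nonneg hmin.1] at h₂
    have h₃ := min_le_right l ρ
    linarith
  have hq : Metric.ball (γ (min l ρ)) (κ₀ * ρ) ⊆ Ω := by
    rcases le_total l ρ with h | h
    · rw [min_eq_left h, hγl]
      refine (Metric.ball_subset_ball ?_).trans hmΩ
      have h₁ : κ₀ * ρ ≤ ρ := mul_le_of_le_one_left hρ.le hκ₀1
      have h₂ : κ₀ * m ≤ m := mul_le_of_le_one_left hm.le hκ₀1
      linarith
    · rw [min_eq_right h]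
      exact (hγκ ρ ⟨hρ.le, h⟩).2.trans hv.subset
  have hl₁ : 0 < 8 * S + 3 * ρ := by linarith
  have hκl₁ : κ * (8 * S + 3 * ρ) ≤ κ₀ * ρ / 2 := by
    have := mul_le_mul_of_nonneg_left hρS1 hκ.le
    have := mul_pos hκ hS
    linarith
  have hpath' : CarrotPath (sublevelIn Ω v t) κ (8 * S + 3 * ρ) x (γ (min l ρ)) := by
    refine hpath.append_segment hκ (by linarith) hl₁ (by linarith) fun w hw => ?_
    refine (Metric.ball_subset_ball hκl₁).trans
      (hv.ball_subset_sublevelIn_of_mem_segment (x := y) hε hΩ (mul_pos hκ₀ hρ)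
        (mul_le_of_le_one_left hρ.le hκ₀1) hp hq (by rwa [dist_comm]) hdq ?_ ?_ hw)
    · have h₁ := mul_le_mul_of_nonneg_right
        (hρm1.trans (mul_le_mul_of_nonneg_left hmε hκ₀.le)) hρ.le
      have h₂ := mul_pos (mul_pos hκ₀ hε) hρ
      linarith [mul_pos hρ hρ]
    · rw [hv.eq_zero y hy]
      have h₁ : κ₀ * ρ ≤ ρ := mul_le_of_le_one_left hρ.le hκ₀1
      have h₂ := mul_le_mul_of_nonneg_left h₁ hσu.le
      have h₃ := mul_le_mul_of_nonneg_left hρS hσu.le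
      have h₄ := mul_le_mul_of_nonneg_right hθσ hS.le
      have h₅ : σl * S = t := mul_div_cancel₀ _ hσ.ne'
      have h₆ := mul_pos hσu hρ
      linarith
  rcases le_total l ρ with h | h
  · rw [min_eq_left h, hγl] at hpath'
    exact ⟨_, hl₁.le, hpath'⟩
  rw [min_eq_right h] at hpath'
  set l₁ := 8 * S + 3 * ρ with hl₁def
  -- The rest of the John curve of `V₀` is run with time shifted by `l₁ - ρ`. The shift is harmless:
  -- `κ * l₁ ≤ κ₀ * ρ / 2` at the junction, and `2 * κ ≤ κ₀` afterwards.
  have := hpath'.append hl₁.le (l' := l₁ + (l - ρ)) (by linarith)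
    (g := fun s => γ (s - l₁ + ρ)) ?_ (by simp) ?_
  · rw [show l₁ + (l - ρ) - l₁ + ρ = l by ring, hγl] at this
    exact ⟨_, by linarith, this⟩
  · refine LipschitzOnWith.of_dist_le_mul fun a ha b hb => ?_
    refine (hγ.dist_le_mul _ ⟨by linarith [ha.1], by linarith [ha.2]⟩ _
      ⟨by linarith [hb.1], by linarith [hb.2]⟩).trans_eq ?_
    rw [dist_add_right, dist_sub_right]
  · intro s hs
    have hmem : s - l₁ + ρ ∈ Icc 0 l := ⟨by linarith [hs.1], by linarith [hs.2]⟩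
    obtain ⟨h₁, h₂⟩ := hγκ _ hmem
    refine ⟨hv.subset_sublevelIn ht h₁,
      (Metric.ball_subset_ball ?_).trans (h₂.trans (hv.subset_sublevelIn ht))⟩
    have h₃ := mul_le_mul_of_nonneg_right hκ2 (sub_nonneg.2 hs.1)
    have h₄ := mul_nonneg hκ₀.le (sub_nonneg.2 hs.1)
    linarith [mul_pos hκ₀ hρ]

/-- The John condition at the end `x₀` bounds the length of the John curves of `V₀`; the
backtracking curve adds at most `t / σl`. -/
theorem dist_center_le (hv : IsTravelTime Ω V₀ v σl σu) (hV : IsJohnDomain V₀ x₀ κ₀) {t : ℝ}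
    {x : 𝔼 n} (hx : x ∈ sublevelIn Ω v t) :
    dist x x₀ ≤ Metric.infDist x₀ (frontier V₀) / κ₀ + t / σl := by
  obtain ⟨a, β, ha, hat, -, hβd, hβ0, hβa⟩ := hv.exists_backtrack x hx.1 t hx.2
  have hκ₀ : 0 < κ₀ := hV.2.2.1
  have h₁ : closure V₀ ⊆ Metric.closedBall x₀ (Metric.infDist x₀ (frontier V₀) / κ₀) := by
    refine closure_minimal (fun y hy => ?_) Metric.isClosed_closedBall
    obtain ⟨l, hl, hκl, γ, hγ, hγ0, hγl, -⟩ := hV.exists_carrotPath hy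
    have h := hγ.dist_le_mul 0 ⟨le_rfl, hl⟩ l ⟨hl, le_rfl⟩
    rw [hγ0, hγl, NNReal.coe_one, one_mul, Real.dist_eq, zero_sub, abs_neg, abs_of_nonneg hl] at h
    refine Metric.mem_closedBall.2 (h.trans ?_)
    rw [le_div_iff₀ hκ₀]
    linarith
  have h₂ := hβd a ⟨ha, le_rfl⟩ 0 ⟨le_rfl, ha⟩
  rw [sub_zero, abs_of_nonneg ha, hβa] at h₂
  have h₃ : dist x (β 0) ≤ t / σl := by
    rw [le_div_iff₀ hv.pos]
    linarith
  have h₄ := dist_triangle x (β 0) x₀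
  have h₅ := Metric.mem_closedBall.1 (h₁ hβ0)
  linarith

/-- The sublevels are John domains. -/
theorem isJohnDomain (hv : IsTravelTime Ω V₀ v σl σu) (hε : 0 < ε)
    (hΩ : HasTouchingBalls Ω ε) (hV : IsJohnDomain V₀ x₀ κ₀) {t κ θ m : ℝ} (ht : 0 < t)
    (hm : 0 < m) (hmε : m ≤ ε) (hmΩ : Metric.ball x₀ m ⊆ Ω) (hθ : 0 < θ)
    (hθσ : 8 * σu * θ ≤ σl) (hθκ : 8 * θ ≤ κ₀) (hκ : 0 < κ) (hκ1 : κ ≤ 1)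
    (hκt : ∀ s, 0 < s → s ≤ t / σl → 32 * κ * s ≤ κ₀ * (θ * min s m)) :
    IsJohnDomain (sublevelIn Ω v t) x₀ κ :=
  isJohnDomain_of_carrotPath
    (Metric.isBounded_closedBall.subset fun _ hx => Metric.mem_closedBall.2 (hv.dist_center_le hV hx))
    (hv.subset_sublevelIn ht hV.2.1) hκ hκ1
    fun _ hx => hv.exists_carrotPath_center hε hΩ hV ht hm hmε hmΩ hθ hθσ hθκ hκ hκt hx

/-- The sublevels are Lipschitz continuous in the Hausdorff distance. -/
theorem hausdorffEDist_sublevelIn_le (hv : IsTravelTime Ω V₀ v σl σu) {s t : ℝ} (hs : 0 < s)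
    (hst : s ≤ t) : Metric.hausdorffEDist (sublevelIn Ω v t) (sublevelIn Ω v s) ≤
      ENNReal.ofReal (1 / σl * (t - s)) := by
  refine Metric.hausdorffEDist_le_of_mem_edist (fun x hx => ?_)
    fun x hx => ⟨x, ⟨hx.1, hx.2.trans_le hst⟩, by simp⟩
  obtain ⟨a, β, ha, hat, hβ, hβd, -, hβa⟩ := hv.exists_backtrack x hx.1 t hx.2
  rcases lt_or_ge a s with has | has
  · refine ⟨x, ⟨hx.1, ?_⟩, by simp⟩
    rw [← hβa]
    exact (hβ a ⟨ha, le_rfl⟩).2.trans_lt has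
  -- The cost `s - (t - a)` is strictly below `s` because `a < t`, and differs from `a` by exactly
  -- `t - s`. The maximum handles a curve that is too short.
  have hc : max 0 (s - (t - a)) ∈ Icc 0 a := ⟨le_max_left _ _, max_le ha (by linarith)⟩
  refine ⟨β (max 0 (s - (t - a))), ⟨(hβ _ hc).1, (hβ _ hc).2.trans_lt (max_lt hs (by linarith))⟩, ?_⟩
  rw [edist_dist]
  refine ENNReal.ofReal_le_ofReal ?_
  have h := hβd a ⟨ha, le_rfl⟩ _ hc
  rw [hβa, abs_of_nonneg (sub_nonneg.2 hc.2)] at h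
  rw [one_div, inv_mul_eq_div, le_div_iff₀ hv.pos]
  have := le_max_right 0 (s - (t - a))
  linarith

/-- The difference of two sublevels is porous on the scales above a multiple of `t - s`. -/
theorem exists_ball_disjoint (hv : IsTravelTime Ω V₀ v σl σu) (hε : 0 < ε)
    (hΩ : HasTouchingBalls Ω ε) (hV : IsJohnDomain V₀ x₀ κ₀) {s t ρ : ℝ} (hs : 0 < s)
    (hρ : 0 < ρ) (hρε : ρ ≤ ε) (hρt : 4 * (t - s) ≤ σl * ρ)
    (hρs : σl * ρ ≤ 4 * s ∨ ρ ≤ Metric.infDist x₀ (frontier V₀)) {x : 𝔼 n}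
    (hx : x ∈ sublevelIn Ω v t \ sublevelIn Ω v s) :
    ∃ p, dist x p + κ₀ * σl / (8 * σu) * ρ ≤ ρ ∧
      Disjoint (Metric.ball p (κ₀ * σl / (8 * σu) * ρ))
        (sublevelIn Ω v t \ sublevelIn Ω v s) := by
  obtain ⟨a, β, ha, hat, hβ, hβd, hβ0, hβa⟩ := hv.exists_backtrack x hx.1.1 t hx.1.2
  have hσ := hv.pos
  have hσu := hv.upper_pos
  have hκ₀ : 0 < κ₀ := hV.2.2.1
  have hκ₀1 : κ₀ ≤ 1 := hV.2.2.2.1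
  have hσσ : 0 < σl / (8 * σu) := by positivity
  have hσσ8 : σl / (8 * σu) ≤ 1 / 8 := by
    rw [div_le_div_iff₀ (by positivity) (by norm_num)]
    linarith [hv.le]
  have hr8 : σl / (8 * σu) * ρ ≤ ρ / 8 := by
    have := mul_le_mul_of_nonneg_right hσσ8 hρ.le
    linarith
  have hcρ : κ₀ * σl / (8 * σu) * ρ ≤ σl / (8 * σu) * ρ := by
    rw [mul_div_assoc]
    exact mul_le_mul_of_nonneg_right (mul_le_of_le_one_left hσσ.le hκ₀1) hρ.le
  have hcρ' : κ₀ * σl / (8 * σu) * ρ ≤ κ₀ * (ρ / 8) := by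
    rw [mul_div_assoc, mul_assoc]
    exact mul_le_mul_of_nonneg_left hr8 hκ₀.le
  have hdisj : ∀ {p : 𝔼 n}, Metric.ball p (κ₀ * σl / (8 * σu) * ρ) ⊆ sublevelIn Ω v s →
      Disjoint (Metric.ball p (κ₀ * σl / (8 * σu) * ρ))
        (sublevelIn Ω v t \ sublevelIn Ω v s) := fun h => disjoint_sdiff_right.mono_left h
  -- If `s` is large for the scale `ρ`, backtrack to level `s - σl * ρ / 4` and push inwards. The
  -- radius `σl / (8 * σu) * ρ` uses up exactly the gained `σl * ρ / 4`. Otherwise the whole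
  -- backtracking curve has length at most `ρ / 2`, and the hole is found in `V₀` along a John
  -- curve.
  by_cases hcase : σl * ρ ≤ 4 * s
  · have hsa : s ≤ a := by
      by_contra! h
      exact hx.2 ⟨hx.1.1, hβa ▸ (hβ a ⟨ha, le_rfl⟩).2.trans_lt h⟩
    have hc : s - σl * ρ / 4 ∈ Icc 0 a := ⟨by linarith, by linarith [mul_pos hσ hρ]⟩
    obtain ⟨hyΩ, hyv⟩ := hβ _ hc
    have hdy := hβd a ⟨ha, le_rfl⟩ _ hc
    rw [hβa, abs_of_nonneg (sub_nonneg.2 hc.2)] at hdy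
    have hdy' : dist x (β (s - σl * ρ / 4)) ≤ ρ / 2 := by
      refine le_of_mul_le_mul_left ?_ hσ
      linarith
    obtain ⟨z, hz, hz0, hzΩ⟩ := hΩ.exists_inward_path hv.isOpen hε hyΩ
    have hr0 : 0 < σl / (8 * σu) * ρ := mul_pos hσσ hρ
    have hdz := hz0 ▸ hz.dist_apply_zero_le hr0.le
    refine ⟨z (σl / (8 * σu) * ρ), ?_, hdisj ((Metric.ball_subset_ball hcρ).trans
      (hv.ball_subset_sublevelIn (hzΩ _ (by linarith)) hdz ?_))⟩
    · have := dist_triangle x (β (s - σl * ρ / 4)) (z (σl / (8 * σu) * ρ))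
      linarith
    · have : 2 * σu * (σl / (8 * σu) * ρ) = σl * ρ / 4 := by
        field_simp
        ring
      linarith
  · have hρD := hρs.resolve_left hcase
    push Not at hcase
    have hdy := hβd a ⟨ha, le_rfl⟩ 0 ⟨le_rfl, ha⟩
    rw [sub_zero, hβa, abs_of_nonneg ha] at hdy
    have hdy' : dist x (β 0) ≤ ρ / 2 := by
      refine le_of_mul_le_mul_left ?_ hσ
      linarith
    obtain ⟨y₁, hy₁, hyy⟩ := Metric.mem_closure_iff.1 hβ0 (ρ / 8) (by positivity)
    obtain ⟨l, hl, -, γ, hγ, hγ0, hγl, hγκ⟩ := hV.exists_carrotPath hy₁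
    have hmin : min l (ρ / 8) ∈ Icc 0 l := ⟨le_min hl (by positivity), min_le_left _ _⟩
    have h₂ := hγ.dist_le_mul 0 ⟨le_rfl, hl⟩ _ hmin
    rw [hγ0, NNReal.coe_one, one_mul, Real.dist_eq, zero_sub, abs_neg, abs_of_nonneg hmin.1] at h₂
    refine ⟨γ (min l (ρ / 8)), ?_, hdisj ?_⟩
    · have h₁ := dist_triangle4 x (β 0) y₁ (γ (min l (ρ / 8)))
      have h₃ := min_le_right l (ρ / 8)
      linarith
    · refine Subset.trans ?_ (hv.subset_sublevelIn hs)
      rcases le_total l (ρ / 8) with h | h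
      · rw [min_eq_left h, hγl]
        exact (Metric.ball_subset_ball (by linarith)).trans (ball_infDist_frontier_subset hV.2.1)
      · rw [min_eq_right h]
        exact (Metric.ball_subset_ball hcρ').trans (hγκ _ ⟨by positivity, h⟩).2

end IsTravelTime

/-! ### Volume of porous sets -/

theorem volume_ball_mul (x y : 𝔼 n) {c r : ℝ} (hc : 0 < c) (hr : 0 < r) :
    volume (Metric.ball x (c * r)) = ENNReal.ofReal (c ^ n) * volume (Metric.closedBall y r) := by
  rw [Measure.addHaar_ball_of_pos _ _ (mul_pos hc hr), Measure.addHaar_closedBall _ _ hr.le,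
    mul_pow, ENNReal.ofReal_mul (by positivity), finrank_euclideanSpace_fin, mul_assoc]

/-- A set with a hole of relative size `c` in every ball of radius `ρ` around its points loses a
fixed fraction of the volume of its neighborhoods when passing from radius `ρ` to `c * ρ`. -/
theorem volume_thickening_add_le {A : Set (𝔼 n)} {c ρ : ℝ} (hc : 0 < c) (hρ : 0 < ρ)
    (hpor : ∀ x ∈ A, ∃ p, dist x p + 2 * c * ρ ≤ ρ ∧ Disjoint (Metric.ball p (2 * c * ρ)) A) :
    volume (Metric.thickening (c * ρ) A) +
      ENNReal.ofReal ((c / 4) ^ n) * volume (Metric.thickening ρ A) ≤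
        volume (Metric.thickening ρ A) := by
  -- In the disjoint Vitali balls of radius `ρ` sit balls of radius `c * ρ`. The enlarged balls of
  -- radius `4 * ρ` cover the whole thickening, whence the fraction `(c / 4) ^ n`.
  obtain ⟨u, huA, hdisj, hcov⟩ := Vitali.exists_disjoint_subfamily_covering_enlargement_closedBall
    A id (fun _ => ρ) ρ (fun _ _ => le_rfl) 4 (by norm_num)
  simp only [id] at hdisj hcov
  choose! p hp hpA using hpor
  have hcount : u.Countable := hdisj.countable_of_nonempty_interior fun x _ => by
    rw [interior_closedBall _ hρ.ne']
    exact ⟨x, Metric.mem_ball_self hρ⟩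
  have hcρ : 0 < c * ρ := mul_pos hc hρ
  have hsub : ∀ x ∈ u, Metric.ball (p x) (c * ρ) ⊆ Metric.ball x ρ := fun x hx =>
    Metric.ball_subset_ball' (by
      rw [dist_comm]
      linarith [hp x (huA hx)])
  have hsum : ENNReal.ofReal ((c / 4) ^ n) * volume (Metric.thickening ρ A) ≤
      volume (⋃ x ∈ u, Metric.ball (p x) (c * ρ)) := by
    rw [measure_biUnion hcount (fun x hx y hy hxy => (hdisj hx hy hxy).mono
      ((hsub x hx).trans Metric.ball_subset_closedBall)
      ((hsub y hy).trans Metric.ball_subset_closedBall)) fun _ _ => measurableSet_ball]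
    have hthick : Metric.thickening ρ A ⊆ ⋃ x ∈ u, Metric.closedBall x (4 * ρ) := by
      intro w hw
      obtain ⟨x, hx, hwx⟩ := Metric.mem_thickening_iff.1 hw
      obtain ⟨y, hy, hxy⟩ := hcov x hx
      exact mem_biUnion hy (hxy hwx.le)
    calc ENNReal.ofReal ((c / 4) ^ n) * volume (Metric.thickening ρ A)
        ≤ ENNReal.ofReal ((c / 4) ^ n) * ∑' x : u, volume (Metric.closedBall (x : 𝔼 n) (4 * ρ)) :=
          mul_le_mul_right ((measure_mono hthick).trans (measure_biUnion_le _ hcount _)) _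
      _ = ∑' x : u, volume (Metric.ball (p x) (c * ρ)) := by
          rw [← ENNReal.tsum_mul_left]
          refine tsum_congr fun x => ?_
          rw [← volume_ball_mul (p x) (x : 𝔼 n) (by positivity) (by positivity),
            show c / 4 * (4 * ρ) = c * ρ by ring]
  refine (add_le_add le_rfl hsum).trans ?_
  rw [← measure_union ?_ (MeasurableSet.biUnion hcount fun _ _ => measurableSet_ball)]
  · refine measure_mono (union_subset ?_ (iUnion₂_subset fun x hx => ?_))
    · intro w hw
      obtain ⟨x, hx, hwx⟩ := Metric.mem_thickening_iff.1 hw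
      have h₁ := hp x hx
      have h₂ : dist x (p x) ≥ 0 := dist_nonneg
      exact Metric.mem_thickening_iff.2 ⟨x, hx, by linarith⟩
    · intro w hw
      exact Metric.mem_thickening_iff.2 ⟨x, huA hx, hsub x hx hw⟩
  -- The holes have radius `2 * c * ρ`, so their concentric halves miss the `c * ρ`-neighborhood of
  -- `A`.
  · rw [disjoint_iUnion₂_right]
    intro x hx
    rw [Set.disjoint_left]
    intro w hw hwx
    obtain ⟨y, hy, hwy⟩ := Metric.mem_thickening_iff.1 hw
    refine Set.disjoint_left.1 (hpA x (huA hx)) (Metric.mem_ball.2 ?_) hy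
    have h₁ := dist_triangle_left y (p x) w
    have h₂ := Metric.mem_ball.1 hwx
    linarith

/-- An exponent for the decay of the volume of the neighborhoods of porous sets. -/
def porosityExponent (n : ℕ) (c : ℝ) : ℝ := min (1 / 2) (Real.log (1 - (c / 4) ^ (n + 1)) / Real.log c)

theorem porosityExponent_mem (n : ℕ) {c : ℝ} (hc : 0 < c) (hc1 : c < 1) :
    porosityExponent n c ∈ Ioo 0 1 := by
  refine ⟨lt_min (by norm_num) (div_pos_of_neg_of_neg ?_ (Real.log_neg hc hc1)),
    (min_le_left _ _).trans_lt (by norm_num)⟩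
  have : (c / 4) ^ (n + 1) < 1 := pow_lt_one₀ (by positivity) (by linarith) (by simp)
  exact Real.log_neg (by linarith) (by linarith [pow_pos (div_pos hc four_pos) (n + 1)])

/-- The power `n + 1` in the exponent keeps the argument of the logarithm positive also for `n = 0`;
the price is a weaker exponent. -/
theorem one_sub_le_rpow_porosityExponent (n : ℕ) {c : ℝ} (hc : 0 < c) (hc1 : c < 1) :
    1 - (c / 4) ^ n ≤ c ^ porosityExponent n c := by
  have h₀ : (c / 4) ^ (n + 1) < 1 := pow_lt_one₀ (by positivity) (by linarith) (by simp)
  have h₁ : (c / 4) ^ (n + 1) ≤ (c / 4) ^ n :=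
    pow_le_pow_of_le_one (by positivity) (by linarith) n.le_succ
  have h₂ : 0 < 1 - (c / 4) ^ (n + 1) := by linarith
  calc 1 - (c / 4) ^ n ≤ 1 - (c / 4) ^ (n + 1) := by linarith
    _ = c ^ (Real.log (1 - (c / 4) ^ (n + 1)) / Real.log c) := by
        rw [Real.rpow_def_of_pos hc, mul_div_cancel₀ _ (Real.log_neg hc hc1).ne, Real.exp_log h₂]
    _ ≤ c ^ porosityExponent n c :=
        Real.rpow_le_rpow_of_exponent_ge hc hc1.le (min_le_right _ _)

/-- Shrink the radius from `ρ₀` by factors `c` until it first drops below `ρ₁`. Each step gains a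
factor `c ^ μ`, and by minimality of the number of steps all scales used are admissible. -/
theorem volume_le_of_porous {A : Set (𝔼 n)} (hA : Bornology.IsBounded A) {c ρ₁ ρ₀ : ℝ} (hc : 0 < c)
    (hc1 : c < 1) (hρ₁ : 0 < ρ₁) (hρ : ρ₁ ≤ ρ₀)
    (hpor : ∀ ρ, ρ₁ ≤ ρ → ρ ≤ ρ₀ → ∀ x ∈ A, ∃ p, dist x p + 2 * c * ρ ≤ ρ ∧
      Disjoint (Metric.ball p (2 * c * ρ)) A) :
    volume A ≤ ENNReal.ofReal ((ρ₁ / ρ₀) ^ porosityExponent n c) *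
      volume (Metric.thickening ρ₀ A) := by
  set μ := porosityExponent n c
  have hμ := porosityExponent_mem n hc hc1
  have hρ₀ : 0 < ρ₀ := hρ₁.trans_le hρ
  have hstep : ∀ ρ, ρ₁ ≤ ρ → ρ ≤ ρ₀ → volume (Metric.thickening (c * ρ) A) ≤
      ENNReal.ofReal (c ^ μ) * volume (Metric.thickening ρ A) := by
    intro ρ h₁ h₂
    have h := volume_thickening_add_le hc (hρ₁.trans_le h₁) (hpor ρ h₁ h₂)
    have hfin : volume (Metric.thickening ρ A) ≠ ⊤ := hA.thickening.measure_lt_top.ne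
    have h₃ := ENNReal.le_sub_of_add_le_right (ENNReal.mul_ne_top ENNReal.ofReal_ne_top hfin) h
    refine h₃.trans (le_trans (le_of_eq ?_) (mul_le_mul_left
      (ENNReal.ofReal_le_ofReal (one_sub_le_rpow_porosityExponent n hc hc1)) _))
    rw [ENNReal.ofReal_sub _ (by positivity), ENNReal.ofReal_one,
      ENNReal.sub_mul fun _ _ => hfin, one_mul]
  have hiter : ∀ k : ℕ, (∀ j < k, ρ₁ ≤ c ^ j * ρ₀) → volume (Metric.thickening (c ^ k * ρ₀) A) ≤
      ENNReal.ofReal ((c ^ k) ^ μ) * volume (Metric.thickening ρ₀ A) := by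
    intro k
    induction k with
    | zero => simp
    | succ k ih =>
      intro hk
      have h₁ := hstep (c ^ k * ρ₀) (hk k k.lt_succ_self)
        (mul_le_of_le_one_left hρ₀.le (pow_le_one₀ hc.le hc1.le))
      rw [pow_succ', mul_assoc]
      refine h₁.trans ((mul_le_mul_right (ih fun j hj => hk j (hj.trans k.lt_succ_self)) _).trans
        (le_of_eq ?_))
      rw [← mul_assoc, ← ENNReal.ofReal_mul (by positivity), Real.mul_rpow hc.le (by positivity)]
  have hex : ∃ k : ℕ, c ^ k * ρ₀ < ρ₁ := by
    obtain ⟨k, hk⟩ := exists_pow_lt_of_lt_one (div_pos hρ₁ hρ₀) hc1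
    exact ⟨k, (lt_div_iff₀ hρ₀).1 hk⟩
  classical
  have hspec := Nat.find_spec hex
  have hmin : ∀ j < Nat.find hex, ρ₁ ≤ c ^ j * ρ₀ := fun j hj => not_lt.1 (Nat.find_min hex hj)
  have hpos : 0 < c ^ Nat.find hex * ρ₀ := by positivity
  refine (measure_mono (Metric.self_subset_thickening hpos A)).trans ((hiter _ hmin).trans ?_)
  refine mul_le_mul_left (ENNReal.ofReal_le_ofReal (Real.rpow_le_rpow (by positivity) ?_ hμ.1.le)) _
  rw [le_div_iff₀ hρ₀]
  exact hspec.le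

theorem rpow_div_mul_pow_le {x a b μ : ℝ} {k : ℕ} (hk : k ≠ 0) (hx : 0 ≤ x) (ha : 0 < a)
    (hab : a ≤ b) (hμ : μ ≤ 1) : (x / a) ^ μ * a ^ k ≤ (x / b) ^ μ * b ^ k := by
  have hb : 0 < b := ha.trans_le hab
  have key : ∀ y : ℝ, 0 < y → (x / y) ^ μ * y ^ k = x ^ μ * y ^ ((k : ℝ) - μ) := by
    intro y hy
    rw [Real.div_rpow hx hy.le, Real.rpow_sub hy, Real.rpow_natCast]
    ring
  rw [key a ha, key b hb]
  refine mul_le_mul_of_nonneg_left (Real.rpow_le_rpow ha.le hab ?_) (Real.rpow_nonneg hx _)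
  have : (1 : ℝ) ≤ k := by exact_mod_cast Nat.one_le_iff_ne_zero.2 hk
  linarith

/-- The constant in the volume estimate. -/
def volumeConst (n : ℕ) (σl σu ε κ₀ D T : ℝ) : ℝ :=
  volume.real (Metric.ball (0 : 𝔼 n) 1) *
    (((D / κ₀ + T / σl) + (ε + 4 * T / σl)) ^ n + ((1 / κ₀ + 2) * ε) ^ n) *
      (4 / (σl * ε)) ^ porosityExponent n (κ₀ * σl / (16 * σu))

/-! ### Hölder continuity of the volume of the sublevels. -/

namespace IsTravelTime

variable {Ω V₀ : Set (𝔼 n)} {v : 𝔼 n → ℝ} {σl σu ε κ₀ : ℝ} {x₀ : 𝔼 n}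

/-- Porosity holds on the scales from `ρ₁` to `ρ₀`. If this range is empty, the factor with
`porosityExponent` is `1` and the bound is that of the enclosing ball. -/
theorem volume_diff_le_of_pos (hv : IsTravelTime Ω V₀ v σl σu) (hε : 0 < ε)
    (hΩ : HasTouchingBalls Ω ε) (hV : IsJohnDomain V₀ x₀ κ₀) {s t : ℝ} (hs : 0 < s)
    (hst : s < t) {ρ₀ ρ₁ R : ℝ}
    (hρ₀ : ρ₀ = min ε (max (4 * s / σl) (Metric.infDist x₀ (frontier V₀))))
    (hρ₁ : ρ₁ = 4 * (t - s) / σl) (hR : R = Metric.infDist x₀ (frontier V₀) / κ₀ + t / σl) :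
    volume (sublevelIn Ω v t \ sublevelIn Ω v s) ≤
      ENNReal.ofReal ((ρ₁ / max ρ₀ ρ₁) ^ porosityExponent n (κ₀ * σl / (16 * σu)) *
        (R + max ρ₀ ρ₁) ^ n) * volume (Metric.ball (0 : 𝔼 n) 1) := by
  have hσ := hv.pos
  have hσu := hv.upper_pos
  have hκ₀ : 0 < κ₀ := hV.2.2.1
  have hκ₀1 : κ₀ ≤ 1 := hV.2.2.2.1
  set A := sublevelIn Ω v t \ sublevelIn Ω v s with hA
  have hρ₁0 : 0 < ρ₁ := by
    rw [hρ₁]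
    exact div_pos (by linarith) hσ
  have hR0 : 0 ≤ R := by
    rw [hR]
    have : 0 ≤ t := by linarith
    have := Metric.infDist_nonneg (x := x₀) (s := frontier V₀)
    positivity
  have hAR : A ⊆ Metric.closedBall x₀ R := fun x hx =>
    Metric.mem_closedBall.2 ((hv.dist_center_le hV hx.1).trans_eq hR.symm)
  have hthick : ∀ ρ, 0 < ρ → volume (Metric.thickening ρ A) ≤
      ENNReal.ofReal ((R + ρ) ^ n) * volume (Metric.ball (0 : 𝔼 n) 1) := by
    intro ρ hρ
    have : Metric.thickening ρ A ⊆ Metric.ball x₀ (R + ρ) := by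
      intro w hw
      obtain ⟨x, hx, hwx⟩ := Metric.mem_thickening_iff.1 hw
      have h₁ := dist_triangle w x x₀
      have h₂ := Metric.mem_closedBall.1 (hAR hx)
      exact Metric.mem_ball.2 (by linarith)
    refine (measure_mono this).trans_eq ?_
    rw [Measure.addHaar_ball_of_pos _ _ (by linarith), finrank_euclideanSpace_fin]
  have hmu0 : 0 ≤ (ρ₁ / max ρ₀ ρ₁) ^ porosityExponent n (κ₀ * σl / (16 * σu)) :=
    Real.rpow_nonneg (div_nonneg hρ₁0.le (hρ₁0.le.trans (le_max_right _ _))) _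
  rw [ENNReal.ofReal_mul hmu0, mul_assoc]
  rcases le_total ρ₀ ρ₁ with h | h
  · rw [max_eq_right h, div_self hρ₁0.ne', Real.one_rpow, ENNReal.ofReal_one, one_mul]
    exact (measure_mono (Metric.self_subset_thickening hρ₁0 A)).trans (hthick ρ₁ hρ₁0)
  · rw [max_eq_left h]
    have hc : 0 < κ₀ * σl / (16 * σu) := by positivity
    have hc1 : κ₀ * σl / (16 * σu) < 1 := by
      rw [div_lt_one (by positivity)]
      have := mul_le_of_le_one_left hσ.le hκ₀1
      linarith [hv.le]
    refine (volume_le_of_porous (Metric.isBounded_closedBall.subset hAR) hc hc1 hρ₁0 h ?_).trans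
      (mul_le_mul_right (hthick ρ₀ (hρ₁0.trans_le h)) _)
    intro ρ h₁ h₂ x hx
    have h₃ : 4 * (t - s) ≤ σl * ρ := by
      rw [hρ₁, div_le_iff₀ hσ] at h₁
      linarith
    have h₄ : ρ ≤ ε := h₂.trans (hρ₀.trans_le (min_le_left _ _))
    have h₅ : σl * ρ ≤ 4 * s ∨ ρ ≤ Metric.infDist x₀ (frontier V₀) := by
      refine (le_max_iff.1 (h₂.trans (hρ₀.trans_le (min_le_right _ _)))).imp_left fun h₆ => ?_
      rw [le_div_iff₀ hσ] at h₆
      linarith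
    have h₆ := hv.exists_ball_disjoint hε hΩ hV hs (hρ₁0.trans_le h₁) h₄ h₃ h₅ hx
    rwa [show κ₀ * σl / (8 * σu) = 2 * (κ₀ * σl / (16 * σu)) by ring] at h₆

/-- The volume between two sublevels is Hölder continuous in the level. -/
theorem volume_diff_le (hv : IsTravelTime Ω V₀ v σl σu) (hε : 0 < ε)
    (hΩ : HasTouchingBalls Ω ε) (hV : IsJohnDomain V₀ x₀ κ₀) {D T s t : ℝ}
    (hD : Metric.infDist x₀ (frontier V₀) ≤ D) (hs : 0 < s) (hst : s ≤ t) (htT : t ≤ T) :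
    volume (sublevelIn Ω v t \ sublevelIn Ω v s) ≤ ENNReal.ofReal (volumeConst n σl σu ε κ₀ D T *
      (t - s) ^ porosityExponent n (κ₀ * σl / (16 * σu))) := by
  rcases hst.eq_or_lt with rfl | hlt
  · simp
  rcases eq_or_ne n 0 with rfl | hn
  · have : sublevelIn Ω v t \ sublevelIn Ω v s = ∅ := by
      refine eq_empty_of_forall_notMem fun x hx => hx.2 ?_
      rw [Subsingleton.elim x x₀]
      exact hv.subset_sublevelIn hs hV.2.1
    rw [this, measure_empty]
    exact zero_le
  have hσ := hv.pos
  have hσu := hv.upper_pos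
  have hκ₀ : 0 < κ₀ := hV.2.2.1
  have hκ₀1 : κ₀ ≤ 1 := hV.2.2.2.1
  have hc : 0 < κ₀ * σl / (16 * σu) := by positivity
  have hc1 : κ₀ * σl / (16 * σu) < 1 := by
    rw [div_lt_one (by positivity)]
    have := mul_le_of_le_one_left hσ.le hκ₀1
    linarith [hv.le]
  obtain ⟨hμ0, hμ1⟩ := porosityExponent_mem n hc hc1
  have hmain := hv.volume_diff_le_of_pos hε hΩ hV hs hlt rfl rfl rfl
  set μ := porosityExponent n (κ₀ * σl / (16 * σu)) with hμ
  set D₀ := Metric.infDist x₀ (frontier V₀) with hD₀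
  set ρ₀ := min ε (max (4 * s / σl) D₀) with hρ₀
  set ρ₁ := 4 * (t - s) / σl with hρ₁
  set ρ := max ρ₀ ρ₁ with hρ
  have hD₀0 : 0 ≤ D₀ := Metric.infDist_nonneg
  have hts : 0 < t - s := sub_pos.2 hlt
  have ht : 0 < t := hs.trans hlt
  have hρ₁0 : 0 < ρ₁ := by positivity
  have hρ0 : 0 < ρ := hρ₁0.trans_le (le_max_right _ _)
  have hT : 0 < T := ht.trans_le htT
  have hD0 : 0 ≤ D := hD₀0.trans hD
  set X := ((D / κ₀ + T / σl) + (ε + 4 * T / σl)) ^ n with hX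
  set Y := ((1 / κ₀ + 2) * ε) ^ n with hY
  have hX0 : 0 ≤ X := by positivity
  have hY0 : 0 ≤ Y := by positivity
  have hR0 : 0 ≤ D₀ / κ₀ + t / σl := by positivity
  -- The constant must not degenerate as `ρ₀` tends to `0`. If `ρ < ε`, then `s` and `D₀` are
  -- bounded by multiples of `ρ`, so the whole set has size comparable to `ρ`, and `(ρ₁ / ρ) ^ μ * ρ
  -- ^ n` increases with `ρ` because `μ < 1 ≤ n`.
  have hbound : (ρ₁ / ρ) ^ μ * (D₀ / κ₀ + t / σl + ρ) ^ n ≤ (ρ₁ / ε) ^ μ * (X + Y) := by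
    rcases le_or_gt ε ρ with h | h
    · have h₁ : (ρ₁ / ρ) ^ μ ≤ (ρ₁ / ε) ^ μ :=
        Real.rpow_le_rpow (by positivity) (div_le_div_of_nonneg_left hρ₁0.le hε h) hμ0.le
      have h₂ : ρ ≤ ε + 4 * T / σl := by
        have h₃ : ρ₁ ≤ 4 * T / σl := div_le_div_of_nonneg_right (by linarith) hσ.le
        exact max_le ((min_le_left _ _).trans (by linarith)) (h₃.trans (by linarith))
      have h₃ : (D₀ / κ₀ + t / σl + ρ) ^ n ≤ X := by
        refine pow_le_pow_left₀ (by positivity) (add_le_add (add_le_add ?_ ?_) h₂) n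
        · exact div_le_div_of_nonneg_right hD hκ₀.le
        · exact div_le_div_of_nonneg_right htT hσ.le
      exact mul_le_mul h₁ (h₃.trans (by linarith)) (by positivity) (by positivity)
    · have h₁ : D₀ / κ₀ + t / σl + ρ ≤ (1 / κ₀ + 2) * ρ := by
        have h₂ : t / σl = 4 * s / σl / 4 + ρ₁ / 4 := by
          rw [hρ₁]
          field_simp
          ring
        have h₃ : ρ₁ ≤ ρ := le_max_right _ _
        have h₄ : max (4 * s / σl) D₀ ≤ ρ := by
          rcases le_total ε (max (4 * s / σl) D₀) with h₅ | h₅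
          · have h₆ : ε ≤ ρ := by
              refine le_trans ?_ (le_max_left _ _)
              rw [hρ₀, min_eq_left h₅]
            exact absurd h₆ (not_le.2 h)
          · rw [hρ, hρ₀, min_eq_right h₅]
            exact le_max_left _ _
        have h₅ := (le_max_left _ _).trans h₄
        have h₆ := div_le_div_of_nonneg_right ((le_max_right _ _).trans h₄) hκ₀.le
        rw [add_mul, one_div_mul_eq_div]
        linarith
      calc (ρ₁ / ρ) ^ μ * (D₀ / κ₀ + t / σl + ρ) ^ n
          ≤ (ρ₁ / ρ) ^ μ * ((1 / κ₀ + 2) * ρ) ^ n :=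
            mul_le_mul_of_nonneg_left (pow_le_pow_left₀ (by positivity) h₁ n) (by positivity)
        _ = (1 / κ₀ + 2) ^ n * ((ρ₁ / ρ) ^ μ * ρ ^ n) := by rw [mul_pow]; ring
        _ ≤ (1 / κ₀ + 2) ^ n * ((ρ₁ / ε) ^ μ * ε ^ n) :=
            mul_le_mul_of_nonneg_left (rpow_div_mul_pow_le hn hρ₁0.le hρ0 h.le hμ1.le)
              (by positivity)
        _ = (ρ₁ / ε) ^ μ * Y := by rw [hY, mul_pow]; ring
        _ ≤ (ρ₁ / ε) ^ μ * (X + Y) := mul_le_mul_of_nonneg_left (by linarith) (by positivity)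
  refine hmain.trans ?_
  rw [← ENNReal.ofReal_toReal (measure_ball_lt_top (μ := volume) (x := (0 : 𝔼 n)) (r := 1)).ne,
    ← ENNReal.ofReal_mul (by positivity)]
  refine ENNReal.ofReal_le_ofReal ((mul_le_mul_of_nonneg_right hbound ENNReal.toReal_nonneg).trans_eq
    ?_)
  rw [volumeConst, ← hX, ← hY, ← hμ, show ρ₁ / ε = 4 / (σl * ε) * (t - s) by
    rw [hρ₁]
    field_simp, Real.mul_rpow (by positivity) hts.le, Measure.real]
  ring

end IsTravelTime

/-! ### The growing sets -/

theorem IsHamiltonian.isTravelTime {Ω V₀ : Set (𝔼 n)} {H : 𝔼 n → 𝔼 n → ℝ} {σl σu : ℝ}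
    (hH : IsHamiltonian Ω H σl σu) (hΩ : IsConstrainingSet Ω) (hV : V₀ ⊆ Ω) (hne : V₀.Nonempty) :
    IsTravelTime Ω V₀ (attachmentTime H Ω V₀) σl σu where
  pos := hH.pos
  le := hH.le
  isOpen := hΩ.isOpen
  subset := hV
  eq_zero _ hx := hH.attachmentTime_eq_zero hV hx
  le_add _ _ hseg := hH.attachmentTime_le_add hΩ hV hne hseg
  exists_backtrack _ hx _ ht := hH.exists_backtrack hΩ hV hne hx ht

/-- The radius of a ball in the constraining set around the John center that is taken into account,
where `d` is the distance of the John center to the frontier, or `0` if there is no frontier. -/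
def innerRadius (ε d : ℝ) : ℝ := if d = 0 then ε else min ε d

/-- The John constant of the growing sets up to time `T`. -/
def johnConst (σl σu ε κ₀ d T : ℝ) : ℝ :=
  κ₀ * (κ₀ * σl / (8 * σu)) / 32 * min 1 (innerRadius ε d * σl / T)

theorem innerRadius_pos {ε d : ℝ} (hε : 0 < ε) (hd : 0 ≤ d) : 0 < innerRadius ε d := by
  rw [innerRadius]
  split_ifs with h
  · exact hε
  · exact lt_min hε (hd.lt_of_ne' h)

theorem innerRadius_le {ε d : ℝ} : innerRadius ε d ≤ ε := by
  rw [innerRadius]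
  split_ifs
  · exact le_rfl
  · exact min_le_left _ _

theorem ball_innerRadius_subset {Ω : Set (𝔼 n)} (hΩ : IsOpen Ω) {x : 𝔼 n} (hx : x ∈ Ω) (ε : ℝ) :
    Metric.ball x (innerRadius ε (Metric.infDist x (frontier Ω))) ⊆ Ω := by
  rw [innerRadius]
  split_ifs with h
  · rcases eq_or_ne Ω univ with rfl | hne
    · exact subset_univ _
    · have hf := nonempty_frontier_iff.2 ⟨⟨x, hx⟩, hne⟩
      have := (isClosed_frontier.mem_iff_infDist_zero hf).2 h
      rw [hΩ.frontier_eq] at this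
      exact absurd hx this.2
  · exact (Metric.ball_subset_ball (min_le_right _ _)).trans (ball_infDist_frontier_subset hx)

theorem tendsto_johnConst (σl σu ε κ₀ d : ℝ) :
    Tendsto (fun T => johnConst σl σu ε κ₀ d T) atTop (𝓝 0) := by
  have h : Tendsto (fun T => innerRadius ε d * σl / T) atTop (𝓝 0) :=
    tendsto_const_nhds.div_atTop tendsto_id
  have := ((tendsto_const_nhds (x := (1 : ℝ))).min h).const_mul (κ₀ * (κ₀ * σl / (8 * σu)) / 32)
  rwa [min_eq_right zero_le_one, mul_zero] at this

theorem IsTravelTime.isJohnDomain_johnConst {Ω V₀ : Set (𝔼 n)} {v : 𝔼 n → ℝ} {x₀ : 𝔼 n}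
    {σl σu ε κ₀ t T : ℝ} (hv : IsTravelTime Ω V₀ v σl σu) (hε : 0 < ε)
    (hΩ : HasTouchingBalls Ω ε) (hV : IsJohnDomain V₀ x₀ κ₀) (ht : 0 < t) (htT : t ≤ T) :
    IsJohnDomain (sublevelIn Ω v t) x₀
      (johnConst σl σu ε κ₀ (Metric.infDist x₀ (frontier Ω)) T) := by
  have hσ := hv.pos
  have hσu := hv.upper_pos
  have hκ₀ : 0 < κ₀ := hV.2.2.1
  have hκ₀1 : κ₀ ≤ 1 := hV.2.2.2.1
  have hT : 0 < T := ht.trans_le htT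
  have hm := innerRadius_pos hε (Metric.infDist_nonneg (x := x₀) (s := frontier Ω))
  have hθ : 0 < κ₀ * σl / (8 * σu) := by positivity
  have hκσ : κ₀ * σl ≤ σl := mul_le_of_le_one_left hσ.le hκ₀1
  have hθσ : 8 * σu * (κ₀ * σl / (8 * σu)) ≤ σl := by
    rwa [mul_div_cancel₀ _ (by positivity)]
  have hθκ : 8 * (κ₀ * σl / (8 * σu)) ≤ κ₀ := by
    rw [mul_div_assoc', div_le_iff₀ (by positivity)]
    have := mul_le_mul_of_nonneg_left hv.le hκ₀.le
    linarith
  have hmin : 0 < min 1 (innerRadius ε (Metric.infDist x₀ (frontier Ω)) * σl / T) :=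
    lt_min one_pos (by positivity)
  refine hv.isJohnDomain hε hΩ hV ht hm innerRadius_le
    (ball_innerRadius_subset hv.isOpen (hv.subset hV.2.1) ε) hθ hθσ hθκ
    (by rw [johnConst]; positivity) ?_ ?_
  · rw [johnConst]
    refine mul_le_one₀ ?_ hmin.le (min_le_left _ _)
    have : κ₀ * (κ₀ * σl / (8 * σu)) ≤ 1 * (κ₀ * σl / (8 * σu)) :=
      mul_le_mul_of_nonneg_right hκ₀1 hθ.le
    linarith
  · intro s hs hst
    rw [johnConst]
    set m := innerRadius ε (Metric.infDist x₀ (frontier Ω))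
    -- On `s ≤ T / σl` the truncated radius `min s m` dominates a linear function, which yields the
    -- factor in `johnConst`.
    have h₁ : min 1 (m * σl / T) * s ≤ min s m := by
      refine le_min (mul_le_of_le_one_left hs.le (min_le_left _ _)) ?_
      calc min 1 (m * σl / T) * s ≤ m * σl / T * (T / σl) :=
            mul_le_mul (min_le_right _ _)
              (hst.trans (div_le_div_of_nonneg_right htT hσ.le)) hs.le (by positivity)
        _ = m := by field_simp
    calc 32 * (κ₀ * (κ₀ * σl / (8 * σu)) / 32 * min 1 (m * σl / T)) * s
        = κ₀ * (κ₀ * σl / (8 * σu)) * (min 1 (m * σl / T) * s) := by ring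
      _ ≤ κ₀ * (κ₀ * σl / (8 * σu)) * min s m := mul_le_mul_of_nonneg_left h₁ (by positivity)
      _ = κ₀ * (κ₀ * σl / (8 * σu) * min s m) := by ring

theorem volumeConst_pos (n : ℕ) {σl σu ε κ₀ D T : ℝ} (hσ : 0 < σl) (hε : 0 < ε) (hκ₀ : 0 < κ₀)
    (hD : 0 ≤ D) (hT : 0 < T) : 0 < volumeConst n σl σu ε κ₀ D T := by
  have h : 0 < volume.real (Metric.ball (0 : 𝔼 n) 1) :=
    ENNReal.toReal_pos (Metric.measure_ball_pos _ _ one_pos).ne' measure_ball_lt_top.ne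
  rw [volumeConst]
  positivity

end AccretiveGrowth
end

theorem proposition3p6 (n : ℕ) :
    -- The constants are functions of `σ_*`, `σ^*`, `ε`, `κ₀`, `d(x₀, ∂Ω)` and `T` only, where the
    -- value `0` stands for `d(x₀, ∂Ω)` if `∂Ω` is empty; `c'` (used in the case `Ω = ℝⁿ`) is also
    -- a function of `d(x₀, ∂V₀)`, its last argument but one.
    ∃ (κ μ c : ℝ → ℝ → ℝ → ℝ → ℝ → ℝ → ℝ) (c' : ℝ → ℝ → ℝ → ℝ → ℝ → ℝ → ℝ),
      ∀ (Ω V₀ : Set (EuclideanSpace ℝ (Fin n))) (x₀ : EuclideanSpace ℝ (Fin n))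
        (H : EuclideanSpace ℝ (Fin n) → EuclideanSpace ℝ (Fin n) → ℝ) (σl σu ε κ₀ : ℝ),
        AccretiveGrowth.IsConstrainingSet Ω →
        0 < ε → AccretiveGrowth.HasTouchingBalls Ω ε →
        AccretiveGrowth.IsHamiltonian Ω H σl σu →
        IsOpen V₀ → V₀ ⊆ Ω → AccretiveGrowth.IsJohnDomain V₀ x₀ κ₀ →
        (∀ T > 0, ∀ t ∈ Ioc 0 T,
          AccretiveGrowth.IsJohnDomain (AccretiveGrowth.growingSet H Ω V₀ t) x₀
            (κ σl σu ε κ₀ (Metric.infDist x₀ (frontier Ω)) T)) ∧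
        Tendsto (fun T => κ σl σu ε κ₀ (Metric.infDist x₀ (frontier Ω)) T) atTop (𝓝 0) ∧
        (∀ s t : ℝ, 0 < s → s ≤ t →
          Metric.hausdorffEDist (AccretiveGrowth.growingSet H Ω V₀ t)
            (AccretiveGrowth.growingSet H Ω V₀ s) ≤ ENNReal.ofReal (1 / σl * (t - s))) ∧
        (∀ T > 0, μ σl σu ε κ₀ (Metric.infDist x₀ (frontier Ω)) T ∈ Ioo 0 1 ∧
          (Ω ≠ univ → 0 < c σl σu ε κ₀ (Metric.infDist x₀ (frontier Ω)) T ∧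
            ∀ s t : ℝ, 0 < s → s ≤ t → t ≤ T →
              volume (AccretiveGrowth.growingSet H Ω V₀ t \ AccretiveGrowth.growingSet H Ω V₀ s) ≤
                ENNReal.ofReal (c σl σu ε κ₀ (Metric.infDist x₀ (frontier Ω)) T *
                  (t - s) ^ μ σl σu ε κ₀ (Metric.infDist x₀ (frontier Ω)) T)) ∧
          (Ω = univ → 0 < c' σl σu ε κ₀ (Metric.infDist x₀ (frontier V₀)) T ∧
            ∀ s t : ℝ, 0 < s → s ≤ t → t ≤ T →
              volume (AccretiveGrowth.growingSet H Ω V₀ t \ AccretiveGrowth.growingSet H Ω V₀ s) ≤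
                ENNReal.ofReal (c' σl σu ε κ₀ (Metric.infDist x₀ (frontier V₀)) T *
                  (t - s) ^ μ σl σu ε κ₀ (Metric.infDist x₀ (frontier Ω)) T))) := by

  refine ⟨AccretiveGrowth.johnConst,
    fun σl σu _ κ₀ _ _ => AccretiveGrowth.porosityExponent n (κ₀ * σl / (16 * σu)),
    AccretiveGrowth.volumeConst n, AccretiveGrowth.volumeConst n, ?_⟩
  intro Ω V₀ x₀ H σl σu ε κ₀ hΩ hε hball hH _ hVΩ hV
  have hv := hH.isTravelTime hΩ hVΩ ⟨x₀, hV.2.1⟩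
  have hσ := hH.pos
  have hσu := hH.upper_pos
  have hκ₀ : 0 < κ₀ := hV.2.2.1
  refine ⟨fun T _ t ht => hv.isJohnDomain_johnConst hε hball hV ht.1 ht.2,
    AccretiveGrowth.tendsto_johnConst _ _ _ _ _,
    fun s t hs hst => hv.hausdorffEDist_sublevelIn_le hs hst,
    fun T hT => ⟨AccretiveGrowth.porosityExponent_mem n (by positivity) ?_, fun hne => ⟨?_, ?_⟩,
      fun _ => ⟨?_, ?_⟩⟩⟩
  · rw [div_lt_one (by positivity)]
    have := mul_le_of_le_one_left hσ.le hV.2.2.2.1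
    linarith [hH.le]
  · exact AccretiveGrowth.volumeConst_pos n hσ hε hκ₀ Metric.infDist_nonneg hT
  · refine fun s t hs hst htT => hv.volume_diff_le hε hball hV ?_ hs hst htT
    -- For `Ω ≠ univ` the ball around `x₀` inscribed in `V₀` lies in `Ω`, so `d(x₀, ∂V₀) ≤ d(x₀,
    -- ∂Ω)` and the constant need not see `V₀`. For `Ω = univ` there is no such bound.
    refine AccretiveGrowth.le_infDist_frontier (nonempty_frontier_iff.2 ⟨⟨x₀, hVΩ hV.2.1⟩, hne⟩) ?_
    exact (AccretiveGrowth.ball_infDist_frontier_subset hV.2.1).trans hVΩ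
  · exact AccretiveGrowth.volumeConst_pos n hσ hε hκ₀ Metric.infDist_nonneg hT
  · exact fun s t hs hst htT => hv.volume_diff_le hε hball hV le_rfl hs hst htT
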